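/- Let $a<b$ and let $\mathcal V\in L^1(\mathbb R,\mathbb R)$ have (essential) support $[a,b]$ and be positive definite on $(a,b)$: $\int_a^b \mathcal V|u|^2\,dx>0$ for every $u\in L^2(\mathbb R)$ which does not vanish a.e. on $(a,b)$ and for which $\mathcal V|u|^2$ is integrable on $(a,b)$. Solutions of $-u''+\mathcal Vu=zu$ on an open set are understood as differentiable functions with locally absolutely continuous derivative which satisfy the equation almost everywhere. For $\zeta\in\mathbb C$ let $\chi_\pm(\cdot,\zeta)$ be the Jost solutions, i.e. the solutions of $-u''+\mathcal Vu=\zeta^2u$ on $\mathbb R$ with $\chi_+(x,\zeta)=e^{i\zeta x}$ for $x>b$ and $\chi_-(x,\zeta)=e^{-i\zeta x}$ for $x<a$; let $w(\zeta)=\chi_+\chi_-'-\chi_+'\chi_-$ be their Wronskian (which does not depend on $x$), and set $$G^\zeta(x,y)=\frac1{w(\zeta)}\begin{cases}\chi_+(x,\zeta)\chi_-(y,\zeta),&x\ge y,\\ \chi_-(x,\zeta)\chi_+(y,\zeta),&x<y,\end{cases}\qquad H^\zeta(x,y)=-\frac1{w(\zeta)}\begin{cases}\chi_+(x,\zeta)\chi_-'(y,\zeta),&x\ge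 y,\\ \chi_-(x,\zeta)\chi_+'(y,\zeta),&x<y.\end{cases}$$ For $k\in\mathbb R$ and $(\theta_1,\theta_2)\in\mathbb C^2$, a generalized eigenfunction $\psi_-(\cdot,k,\theta_1,\theta_2)$ is a solution of $-u''+\mathcal Vu=k^2u$ on $\mathbb R\setminus\{a,b\}$ that fulfils the interface conditions $$e^{-\theta_1/2}u(b^+)=u(b^-),\quad e^{-\theta_2/2}u'(b^+)=u'(b^-),\quad e^{-\theta_1/2}u(a^-)=u(a^+),\quad e^{-\theta_2/2}u'(a^-)=u'(a^+)$$ and, for some $R,T\in\mathbb C$, the exterior conditions: if $k\ge0$, $u(x)=e^{ikx}+Re^{-ikx}$ for $x<a$ and $u(x)=Te^{ikx}$ for $x>b$; if $k<0$, $u(x)=Te^{ikx}$ for $x<a$ and $u(x)=e^{ikx}+Re^{-ikx}$ for $x>b$. Write $\psi_-(\cdot,k)=\psi_-(\cdot,k,0,0)$. Then there is $\delta>0$ such that, with $\mathcal B_\delta$ the open ball of radius $\delta$ around the origin of $\mathbb C^2$, a generalized eigenfunction $\psi_-(\cdot,k,\theta_1,\theta_2)$ exists for all $(k,\theta_1,\theta_2)\in\mathbb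 R\times\mathcal B_\delta$, and every such function satisfies, on $\mathbb R\setminus\{a,b\}$, $$\psi_-(\cdot,k,\theta_1,\theta_2)-\psi_-(\cdot,k)=\mathcal O(\theta_2k)\,G^{\sigma k}(\cdot,b)+\mathcal O\Big(\frac{\theta_1k}{1+|k|}\Big)H^{\sigma k}(\cdot,b)+\mathcal O(\theta_2k)\,G^{\sigma k}(\cdot,a)+\mathcal O\Big(\frac{\theta_1k}{1+|k|}\Big)H^{\sigma k}(\cdot,a),$$ where $\sigma=\operatorname{sign}k$ (so $\sigma k=|k|$). Here $\mathcal O(g)$ denotes a function of $(k,\theta_1,\theta_2)$ of the form $p\,g$ with $p:\mathbb R\times\mathcal B_\delta\to\mathbb C$ bounded. -/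

import Mathlib

open Set Filter Topology MeasureTheory

noncomputable section

namespace InterfaceScattering

/-- The generalized Landau symbol: `f = O(g)` on `X` if `f = p g` on all of `X`, for some bounded
map `p : X → ℂ`. -/
def IsLandauO {X : Type*} (f g : X → ℂ) : Prop :=
  ∃ p : X → ℂ, (∃ C : ℝ, ∀ x, ‖p x‖ ≤ C) ∧ ∀ x, f x = p x * g x

/-- The support of a (locally) integrable function, insensitive to null sets: the support of the
measure `|V(x)| dx`. -/
def essSupport (V : ℝ → ℝ) : Set ℝ :=
  (volume.withDensity (fun x => ‖V x‖ₑ)).support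

/-- `V` is positive definite on `(a, b)`: `⟨u, V u⟩_{L²(a,b)} > 0` for every `u ∈ L²(ℝ)` that is not
almost everywhere zero on `(a, b)` and for which the form is defined. -/
def IsPositiveDefiniteOn (V : ℝ → ℝ) (a b : ℝ) : Prop :=
  ∀ u : ℝ → ℂ, MemLp u 2 volume →
    ¬ (∀ᵐ x ∂(volume.restrict (Ioo a b)), u x = 0) →
    IntegrableOn (fun x => V x * ‖u x‖ ^ 2) (Ioo a b) →
    0 < ∫ x in Ioo a b, V x * ‖u x‖ ^ 2

/-- `u` solves `-u'' + V u = z u` on the open set `s`, with `V` merely integrable: `u` is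
differentiable on `s`, its derivative is locally absolutely continuous on `s`, and the equation
holds almost everywhere on `s`. -/
structure IsSolutionOn (V : ℝ → ℝ) (z : ℂ) (s : Set ℝ) (u : ℝ → ℂ) : Prop where
  differentiable : ∀ x ∈ s, DifferentiableAt ℝ u x
  absolutelyContinuous : ∀ x y : ℝ, x ≤ y → Icc x y ⊆ s →
    AbsolutelyContinuousOnInterval (deriv u) x y
  equation : ∀ᵐ x : ℝ, x ∈ s → HasDerivAt (deriv u) ((V x : ℂ) * u x - z * u x) x

/-- The Jost solution `χ₊(·, ζ)`: the solution of `-u'' + V u = ζ² u` on `ℝ` which equals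
`exp (i ζ x)` for `x > b`. It exists and is unique for `V` integrable and
zero almost everywhere outside `[a, b]`. -/
def jostPlus (V : ℝ → ℝ) (b : ℝ) (ζ : ℂ) : ℝ → ℂ :=
  Classical.epsilon fun u : ℝ → ℂ =>
    IsSolutionOn V (ζ ^ 2) univ u ∧ ∀ x : ℝ, b < x → u x = Complex.exp (Complex.I * ζ * x)

/-- The Jost solution `χ₋(·, ζ)`: the solution of `-u'' + V u = ζ² u` on `ℝ` which equals
`exp (-i ζ x)` for `x < a`. It exists and is unique for `V` integrable and
zero almost everywhere outside `[a, b]`. -/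
def jostMinus (V : ℝ → ℝ) (a : ℝ) (ζ : ℂ) : ℝ → ℂ :=
  Classical.epsilon fun u : ℝ → ℂ =>
    IsSolutionOn V (ζ ^ 2) univ u ∧ ∀ x : ℝ, x < a → u x = Complex.exp (-(Complex.I * ζ * x))

/-- The Wronskian `f g' - f' g`. -/
def wronskian (f g : ℝ → ℂ) (x : ℝ) : ℂ :=
  f x * deriv g x - deriv f x * g x

/-- The Jost function `w(ζ)`, the Wronskian of `χ₊(·, ζ)` and `χ₋(·, ζ)`. It does not depend on
the point of evaluation, for which we take `a`. -/
def jostFunction (V : ℝ → ℝ) (a b : ℝ) (ζ : ℂ) : ℂ :=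
  wronskian (jostPlus V b ζ) (jostMinus V a ζ) a

/-- The Green's function `G^ζ(x, y)`. -/
def greenG (V : ℝ → ℝ) (a b : ℝ) (ζ : ℂ) (x y : ℝ) : ℂ :=
  (jostFunction V a b ζ)⁻¹ *
    (if y ≤ x then jostPlus V b ζ x * jostMinus V a ζ y
      else jostMinus V a ζ x * jostPlus V b ζ y)

/-- The function `H^ζ(x, y)`. -/
def greenH (V : ℝ → ℝ) (a b : ℝ) (ζ : ℂ) (x y : ℝ) : ℂ :=
  -(jostFunction V a b ζ)⁻¹ *
    (if y ≤ x then jostPlus V b ζ x * deriv (jostMinus V a ζ) y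
      else jostMinus V a ζ x * deriv (jostPlus V b ζ) y)

/-- The non-mixed interface conditions at `a` and `b`. The one-sided boundary values of `u` and
`u'` are required to exist. -/
def InterfaceConditions (a b : ℝ) (θ₁ θ₂ : ℂ) (u : ℝ → ℂ) : Prop :=
  ∃ ubr ubl dbr dbl ual uar dal dar : ℂ,
    Tendsto u (𝓝[>] b) (𝓝 ubr) ∧ Tendsto u (𝓝[<] b) (𝓝 ubl) ∧
    Tendsto (deriv u) (𝓝[>] b) (𝓝 dbr) ∧ Tendsto (deriv u) (𝓝[<] b) (𝓝 dbl) ∧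
    Tendsto u (𝓝[<] a) (𝓝 ual) ∧ Tendsto u (𝓝[>] a) (𝓝 uar) ∧
    Tendsto (deriv u) (𝓝[<] a) (𝓝 dal) ∧ Tendsto (deriv u) (𝓝[>] a) (𝓝 dar) ∧
    Complex.exp (-θ₁ / 2) * ubr = ubl ∧ Complex.exp (-θ₂ / 2) * dbr = dbl ∧
    Complex.exp (-θ₁ / 2) * ual = uar ∧ Complex.exp (-θ₂ / 2) * dal = dar

/-- The exterior conditions of a wave of momentum `k` coming in from the left (`k ≥ 0`) or from
the right (`k < 0`), with reflection coefficient `R` and transmission coefficient `T`. -/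
def ExteriorConditions (a b k : ℝ) (u : ℝ → ℂ) : Prop :=
  ∃ R T : ℂ,
    (0 ≤ k →
      (∀ x : ℝ, x < a →
        u x = Complex.exp (Complex.I * k * x) + R * Complex.exp (-(Complex.I * k * x))) ∧
      (∀ x : ℝ, b < x → u x = T * Complex.exp (Complex.I * k * x))) ∧
    (k < 0 →
      (∀ x : ℝ, x < a → u x = T * Complex.exp (Complex.I * k * x)) ∧
      (∀ x : ℝ, b < x →
        u x = Complex.exp (Complex.I * k * x) + R * Complex.exp (-(Complex.I * k * x))))

/-- `u` is a generalized eigenfunction `ψ₋(·, k, θ₁, θ₂)`. Its values at `a` and `b` are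
immaterial. -/
structure IsGenEigenfunction (V : ℝ → ℝ) (a b k : ℝ) (θ₁ θ₂ : ℂ) (u : ℝ → ℂ) : Prop where
  solution : IsSolutionOn V ((k : ℂ) ^ 2) ({a, b}ᶜ) u
  interface : InterfaceConditions a b θ₁ θ₂ u
  exterior : ExteriorConditions a b k u

end InterfaceScattering

end

/-! Put `κ = |k|`. Outside `[a, b]` a generalized eigenfunction is a sum of plane waves with unknown
outgoing amplitudes. Eliminating these from the interface conditions leaves a Robin problem for the
interior part `u`: `u' + iκτu = iκ ca` at `a` and `u' - iκτu = -iκ cb` at `b`, where `τ = exp((θ₁ -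
θ₂)/2)` is close to `1` and the sources are bounded.

For `κ > 0`, conservation of the flux `Im(u' ū)` bounds `u(a)` and `u(b)` uniformly in `κ`, and the
boundary conditions then give `u' = O(κ)` at both ends. The same identity yields uniqueness; at `κ =
0` the conditions become Neumann conditions, and positivity of `V` takes over. Uniqueness gives
existence by shooting (`exists_isRobinSolution`) and also shows that the Jost function has no zero
on `[0, ∞)`.

The factor `κ/(1 + κ)` requires `u(a), u(b) = O(κ)` at low energy (`exists_robin_bound`). The
Wronskian of `u` with a zero-energy solution `φ`, `φ(a) = 1`, `φ'(a) = 0`, varies by `O(κ)` over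
`[a, b]`. As `φ'(b) ≠ 0` by positivity, `u(b)` can be solved for; `u(a)` is symmetric.

Finally, the difference of `ψ` and `ψ₀` is outgoing, and its jumps at the interfaces are `exp(θ/2) -
1` times boundary data of `u`. Constancy of Wronskians turns this into the representation by `G` and
`H` (`genEigenfunction_sub_eq`), whose coefficients are controlled by the Robin bounds. -/

noncomputable section

namespace InterfaceScattering

/-! ### Global solutions of Lipschitz differential equations -/

lemma abs_integral_exp_abs_le {K : ℝ} (hK : 0 < K) (c t : ℝ) :
    |∫ s in c..t, Real.exp (K * |s - c|)| ≤ Real.exp (K * |t - c|) / K := by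
  rcases le_total c t with h | h
  · have h1 : ∫ s in c..t, Real.exp (K * |s - c|) = ∫ s in c..t, Real.exp (K * (s - c)) := by
      refine intervalIntegral.integral_congr fun s hs => ?_
      rw [uIcc_of_le h] at hs
      simp only [abs_of_nonneg (sub_nonneg.2 hs.1)]
    have h2 : ∀ s ∈ uIcc c t, HasDerivAt (fun s => Real.exp (K * (s - c)) / K)
        (Real.exp (K * (s - c))) s := fun s _ => by
      refine ((((hasDerivAt_id' s).sub_const c).const_mul K).exp.div_const K).congr_deriv ?_
      field_simp
    rw [h1, intervalIntegral.integral_eq_sub_of_hasDerivAt h2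
      (by apply Continuous.intervalIntegrable; fun_prop), abs_of_nonneg (sub_nonneg.2 h)]
    have h3 : 1 ≤ Real.exp (K * (t - c)) :=
      Real.one_le_exp (mul_nonneg hK.le (sub_nonneg.2 h))
    rw [sub_self, mul_zero, Real.exp_zero, ← sub_div, abs_of_nonneg (by
      apply div_nonneg _ hK.le; linarith)]
    gcongr
    linarith
  · have h1 : ∫ s in c..t, Real.exp (K * |s - c|) = ∫ s in c..t, Real.exp (K * (c - s)) := by
      refine intervalIntegral.integral_congr fun s hs => ?_
      rw [uIcc_of_ge h] at hs
      simp only [abs_of_nonpos (sub_nonpos.2 hs.2), neg_sub]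
    have h2 : ∀ s ∈ uIcc c t, HasDerivAt (fun s => -(Real.exp (K * (c - s)) / K))
        (Real.exp (K * (c - s))) s := fun s _ => by
      refine ((((hasDerivAt_id' s).const_sub c).const_mul K).exp.div_const K).neg.congr_deriv ?_
      field_simp
    rw [h1, intervalIntegral.integral_eq_sub_of_hasDerivAt h2
      (by apply Continuous.intervalIntegrable; fun_prop), abs_of_nonpos (sub_nonpos.2 h), neg_sub]
    have h3 : 1 ≤ Real.exp (K * (c - t)) :=
      Real.one_le_exp (mul_nonneg hK.le (sub_nonneg.2 h))
    rw [sub_self, mul_zero, Real.exp_zero, neg_sub_neg, ← sub_div, abs_div, abs_of_pos hK,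
      abs_of_nonpos (by linarith)]
    gcongr
    linarith

/-- Global existence for an ordinary differential equation whose right-hand side is Lipschitz
in space, uniformly in time, and vanishes at the origin. -/
theorem exists_global_solution {E : Type*} [NormedAddCommGroup E] [NormedSpace ℝ E]
    [CompleteSpace E] {f : ℝ → E → E} {K : ℝ} (hK : 0 < K)
    (hf : Continuous fun p : ℝ × E => f p.1 p.2)
    (hlip : ∀ t x y, ‖f t x - f t y‖ ≤ K * ‖x - y‖) (hzero : ∀ t, f t 0 = 0) (c : ℝ) (x₀ : E) :
    ∃ F : ℝ → E, F c = x₀ ∧ ∀ t, HasDerivAt F (f t (F t)) t := by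
  -- In the supremum norm weighted by `1/ω`, the Picard map has Lipschitz constant `K/(2K) = 1/2`,
  -- so a single contraction argument covers the whole line. The bounded function `g` stands for the
  -- solution divided by `ω`.
  let ω : ℝ → ℝ := fun t => Real.exp (2 * K * |t - c|)
  have hω : Continuous ω := by fun_prop
  have hωpos : ∀ t, 0 < ω t := fun t => Real.exp_pos _
  have hω1 : ∀ t, 1 ≤ ω t := fun t => Real.one_le_exp (by positivity)
  let P : BoundedContinuousFunction ℝ E → ℝ → E := fun g t => x₀ + ∫ s in c..t, f s (ω s • g s)
  have hint : ∀ g : BoundedContinuousFunction ℝ E, Continuous fun s => f s (ω s • g s) := fun g =>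
    hf.comp (continuous_id.prodMk (hω.smul g.continuous))
  have hPderiv : ∀ (g : BoundedContinuousFunction ℝ E) t, HasDerivAt (P g) (f t (ω t • g t)) t := fun g t =>
    ((hint g).integral_hasStrictDerivAt c t).hasDerivAt.const_add x₀
  have hPcont : ∀ g : BoundedContinuousFunction ℝ E, Continuous (P g) := fun g =>
    continuous_iff_continuousAt.2 fun t => (hPderiv g t).continuousAt
  have key : ∀ (h : ℝ → E) (M : ℝ), 0 ≤ M → (∀ s, ‖h s‖ ≤ K * (ω s * M)) → ∀ t,
      ‖(ω t)⁻¹ • ∫ s in c..t, h s‖ ≤ M / 2 := by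
    intro h M hM hh t
    have h1 : ‖∫ s in c..t, h s‖ ≤ |∫ s in c..t, K * M * ω s| := by
      refine intervalIntegral.norm_integral_le_abs_of_norm_le (.of_forall fun s => ?_)
        (by apply Continuous.intervalIntegrable; fun_prop)
      exact (hh s).trans (le_of_eq (by ring))
    rw [intervalIntegral.integral_const_mul, abs_mul, abs_of_nonneg (by positivity)] at h1
    have h2 := abs_integral_exp_abs_le (K := 2 * K) (by positivity) c t
    rw [norm_smul, norm_inv, Real.norm_of_nonneg (hωpos t).le, inv_mul_le_iff₀ (hωpos t)]
    calc _ ≤ _ := h1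
      _ ≤ K * M * (ω t / (2 * K)) := by gcongr
      _ = ω t * (M / 2) := by field_simp
  have hbound : ∀ (g : BoundedContinuousFunction ℝ E) t,
      ‖(ω t)⁻¹ • P g t‖ ≤ ‖x₀‖ + ‖g‖ / 2 := by
    intro g t
    simp only [P, smul_add]
    refine (norm_add_le _ _).trans (add_le_add ?_ ?_)
    · rw [norm_smul, norm_inv, Real.norm_of_nonneg (hωpos t).le, inv_mul_le_iff₀ (hωpos t)]
      exact le_mul_of_one_le_left (norm_nonneg _) (hω1 t)
    · refine key _ _ (norm_nonneg _) (fun s => ?_) t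
      have := hlip s (ω s • g s) 0
      rw [hzero, sub_zero, sub_zero, norm_smul, Real.norm_of_nonneg (hωpos s).le] at this
      refine this.trans ?_
      have := g.norm_coe_le_norm s
      have := hωpos s
      gcongr
  let T : BoundedContinuousFunction ℝ E → BoundedContinuousFunction ℝ E := fun g =>
    BoundedContinuousFunction.ofNormedAddCommGroup (fun t => (ω t)⁻¹ • P g t)
      ((hω.inv₀ fun t => (hωpos t).ne').smul (hPcont _)) _ (hbound g)
  have hT : ContractingWith (1 / 2) T := by
    refine ⟨by norm_num, LipschitzWith.of_dist_le_mul fun g h => ?_⟩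
    refine (BoundedContinuousFunction.dist_le (by positivity)).2 fun t => ?_
    have e : T g t - T h t =
        (ω t)⁻¹ • ∫ s in c..t, (f s (ω s • g s) - f s (ω s • h s)) := by
      rw [intervalIntegral.integral_sub ((hint g).intervalIntegrable _ _)
        ((hint h).intervalIntegrable _ _)]
      simp only [T, P, BoundedContinuousFunction.coe_ofNormedAddCommGroup, ← smul_sub]
      congr 1
      simp only [add_sub_add_left_eq_sub]
    rw [dist_eq_norm, e]
    refine (key _ _ (dist_nonneg (x := g) (y := h)) (fun s => ?_) t).trans
      (le_of_eq (by simp; ring))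
    refine (hlip _ _ _).trans ?_
    rw [← smul_sub, norm_smul, Real.norm_of_nonneg (hωpos s).le, ← dist_eq_norm]
    have := BoundedContinuousFunction.dist_coe_le_dist (f := g) (g := h) s
    have := hωpos s
    gcongr
  let g := ContractingWith.fixedPoint T hT
  have hg : ∀ t, ω t • g t = P g t := fun t => by
    have : T g t = g t := by rw [hT.fixedPoint_isFixedPt]
    rw [← this]
    simp [T, smul_smul, (hωpos t).ne']
  refine ⟨P g, by simp [P], fun t => ?_⟩
  rw [← hg]
  exact hPderiv _ t

lemma absolutelyContinuousOnInterval_of_dist_le {X Y : Type*} [PseudoMetricSpace X]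
    [PseudoMetricSpace Y] {f : ℝ → X} {g : ℝ → Y} {c d : ℝ}
    (hf : AbsolutelyContinuousOnInterval f c d)
    (hfg : ∀ x ∈ uIcc c d, ∀ y ∈ uIcc c d, dist (g x) (g y) ≤ dist (f x) (f y)) :
    AbsolutelyContinuousOnInterval g c d := by
  rw [absolutelyContinuousOnInterval_iff] at hf ⊢
  intro ε hε
  obtain ⟨δ, hδ, h⟩ := hf ε hε
  exact ⟨δ, hδ, fun E hE hE' => (Finset.sum_le_sum fun i hi =>
    hfg _ (hE.1 i hi).1 _ (hE.1 i hi).2).trans_lt (h E hE hE')⟩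

lemma absolutelyContinuousOnInterval_of_hasDerivAt {E : Type*} [NormedAddCommGroup E]
    [NormedSpace ℝ E] {f f' : ℝ → E} {c d : ℝ} (hf : ∀ x ∈ uIcc c d, HasDerivAt f (f' x) x)
    (hf' : ContinuousOn f' (uIcc c d)) : AbsolutelyContinuousOnInterval f c d := by
  obtain ⟨C, hC⟩ := isCompact_uIcc.exists_bound_of_continuousOn hf'
  have hC' : LipschitzOnWith C.toNNReal f (uIcc c d) :=
    (convex_uIcc c d).lipschitzOnWith_of_nnnorm_hasDerivWithin_le
      (fun x hx => (hf x hx).hasDerivWithinAt)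
      (fun x hx => by
        rw [← NNReal.coe_le_coe, coe_nnnorm]
        exact (hC x hx).trans (Real.le_coe_toNNReal C))
  exact hC'.absolutelyContinuousOnInterval

/-! ### Integrable potentials: quasi-derivatives and the initial value problem -/

/-- A primitive of the potential. -/
def primitive (V : ℝ → ℝ) (x : ℝ) : ℝ := ∫ t in (0 : ℝ)..x, V t

lemma continuous_primitive {V : ℝ → ℝ} (hV : Integrable V) : Continuous (primitive V) :=
  intervalIntegral.continuous_primitive (fun _ _ => hV.intervalIntegrable) 0

lemma abs_primitive_le {V : ℝ → ℝ} (hV : Integrable V) (x : ℝ) :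
    |primitive V x| ≤ ∫ t, |V t| := by
  have h1 : ‖∫ t in (0 : ℝ)..x, V t‖ ≤ ∫ t in uIoc 0 x, ‖V t‖ :=
    intervalIntegral.norm_integral_le_integral_norm_uIoc
  exact h1.trans (setIntegral_le_integral hV.norm (.of_forall fun _ => norm_nonneg _))

lemma ae_hasDerivAt_primitive {V : ℝ → ℝ} (hV : Integrable V) :
    ∀ᵐ x, HasDerivAt (primitive V) (V x) x := by
  filter_upwards [LocallyIntegrable.ae_hasDerivAt_integral hV.locallyIntegrable] with x hx using hx 0

lemma absolutelyContinuousOnInterval_primitive {V : ℝ → ℝ} (hV : Integrable V) (c d : ℝ) :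
    AbsolutelyContinuousOnInterval (primitive V) c d := by
  have h : IntervalIntegrable V volume (min 0 (min c d)) (max 0 (max c d)) :=
    hV.intervalIntegrable
  have hle : min 0 (min c d) ≤ max 0 (max c d) := (min_le_left _ _).trans (le_max_left _ _)
  refine (h.absolutelyContinuousOnInterval_intervalIntegral (c := 0) ?_).mono ?_
  · rw [uIcc_of_le hle]; exact ⟨min_le_left _ _, le_max_left _ _⟩
  · rw [uIcc_of_le hle]
    exact Icc_subset_Icc (min_le_right _ _) (le_max_right _ _)

/-- The quasi-derivative `u' - W u`, with `W` a primitive of the potential. It is continuously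
differentiable for every solution `u`. -/
def quasiDeriv (V : ℝ → ℝ) (u : ℝ → ℂ) (x : ℝ) : ℂ := deriv u x - primitive V x * u x

lemma IsSolutionOn.continuousOn {V : ℝ → ℝ} {z : ℂ} {s : Set ℝ} {u : ℝ → ℂ}
    (hu : IsSolutionOn V z s u) : ContinuousOn u s :=
  fun x hx => (hu.differentiable x hx).continuousAt.continuousWithinAt

lemma exists_Ioo_Icc_subset {s : Set ℝ} (hs : IsOpen s) {x : ℝ} (hx : x ∈ s) :
    ∃ c d : ℝ, x ∈ Ioo c d ∧ Icc c d ⊆ s := by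
  obtain ⟨ε, hε, h⟩ := Metric.nhds_basis_closedBall.mem_iff.1 (hs.mem_nhds hx)
  rw [Real.closedBall_eq_Icc] at h
  exact ⟨x - ε, x + ε, ⟨by linarith, by linarith⟩, h⟩

lemma IsSolutionOn.continuousOn_deriv {V : ℝ → ℝ} {z : ℂ} {s : Set ℝ} {u : ℝ → ℂ}
    (hu : IsSolutionOn V z s u) (hs : IsOpen s) : ContinuousOn (deriv u) s := by
  intro x hx
  obtain ⟨c, d, hxcd, hcd⟩ := exists_Ioo_Icc_subset hs hx
  have hle := (hxcd.1.trans hxcd.2).le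
  have := (hu.absolutelyContinuous c d hle hcd).continuousOn
  rw [uIcc_of_le hle] at this
  exact (this.continuousAt (Icc_mem_nhds hxcd.1 hxcd.2)).continuousWithinAt

/-- The two terms with `V` cancel, so almost everywhere the derivative is the continuous function
`q`. Minus a primitive of `q`, the quasi-derivative is absolutely continuous with derivative zero
almost everywhere, hence constant; this gives the derivative at every point. -/
lemma IsSolutionOn.hasDerivAt_quasiDeriv {V : ℝ → ℝ} (hV : Integrable V) {z : ℂ} {s : Set ℝ}
    (hs : IsOpen s) {u : ℝ → ℂ} (hu : IsSolutionOn V z s u) {x : ℝ} (hx : x ∈ s) :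
    HasDerivAt (quasiDeriv V u) (-(z * u x) - primitive V x * deriv u x) x := by
  obtain ⟨c, d, hxcd, hcd⟩ := exists_Ioo_Icc_subset hs hx
  have hle := (hxcd.1.trans hxcd.2).le
  have huIcc : uIcc c d = Icc c d := uIcc_of_le hle
  let q : ℝ → ℂ := fun y => -(z * u y) - primitive V y * deriv u y
  have hq : ContinuousOn q s :=
    ((continuousOn_const.mul hu.continuousOn).neg).sub
      ((Complex.continuous_ofReal.comp (continuous_primitive hV)).continuousOn.mul
        (hu.continuousOn_deriv hs))
  have hqderiv : ∀ y ∈ uIcc c d, HasDerivAt (fun y => ∫ t in x..y, q t) (q y) y := by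
    intro y hy
    rw [huIcc] at hy
    have hyx : uIcc x y ⊆ s := (uIcc_subset_Icc (Ioo_subset_Icc_self hxcd) hy).trans hcd
    exact intervalIntegral.integral_hasDerivAt_right (hq.mono hyx).intervalIntegrable
      (hq.stronglyMeasurableAtFilter hs y (hcd hy)) (hq.continuousAt (hs.mem_nhds (hcd hy)))
  have hac : AbsolutelyContinuousOnInterval
      (fun y => (deriv u y - primitive V y • u y) - ∫ t in x..y, q t) c d := by
    refine AbsolutelyContinuousOnInterval.sub (AbsolutelyContinuousOnInterval.sub
      (hu.absolutelyContinuous c d hle hcd) ?_) ?_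
    · refine (absolutelyContinuousOnInterval_primitive hV c d).fun_smul
        (absolutelyContinuousOnInterval_of_hasDerivAt (f' := deriv u) (fun y hy => ?_) ?_)
      · exact (hu.differentiable y (hcd (huIcc ▸ hy))).hasDerivAt
      · exact (hu.continuousOn_deriv hs).mono (huIcc ▸ hcd)
    · exact absolutelyContinuousOnInterval_of_hasDerivAt hqderiv (hq.mono (huIcc ▸ hcd))
  obtain ⟨C, hC⟩ := hac.const_of_ae_hasDerivAt_zero (by
    filter_upwards [hu.equation, ae_hasDerivAt_primitive hV] with y hy hy' hycd
    have hys := hcd (huIcc ▸ hycd)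
    refine (((hy hys).sub (hy'.smul (hu.differentiable y hys).hasDerivAt)).sub
      (hqderiv y hycd)).congr_deriv ?_
    simp only [q, Complex.real_smul]
    ring)
  have heq : quasiDeriv V u =ᶠ[𝓝 x] fun y => C + ∫ t in x..y, q t := by
    filter_upwards [Icc_mem_nhds hxcd.1 hxcd.2] with y hy
    rw [← hC y (huIcc ▸ hy)]
    simp [quasiDeriv]
  exact ((hqderiv x (huIcc ▸ Ioo_subset_Icc_self hxcd)).const_add C).congr_of_eventuallyEq heq

/-- The vector field of the first order system for a solution and its quasi-derivative. -/
def quasiField (V : ℝ → ℝ) (z : ℂ) (t : ℝ) (p : ℂ × ℂ) : ℂ × ℂ :=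
  (p.2 + primitive V t * p.1, -(z * p.1) - primitive V t * (p.2 + primitive V t * p.1))

lemma quasiField_sub (V : ℝ → ℝ) (z : ℂ) (t : ℝ) (p q : ℂ × ℂ) :
    quasiField V z t p - quasiField V z t q = quasiField V z t (p - q) := by
  ext <;> simp [quasiField] <;> ring

/-- The primitive is bounded by the `L¹` norm of `V`, so the system, though time dependent, has a
global Lipschitz constant. -/
lemma norm_quasiField_le {V : ℝ → ℝ} (hV : Integrable V) (z : ℂ) (t : ℝ) (p : ℂ × ℂ) :
    ‖quasiField V z t p‖ ≤ ((1 + ∫ t, |V t|) ^ 2 + ‖z‖) * ‖p‖ := by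
  set M := ∫ t, |V t|
  have hM : ‖(primitive V t : ℂ)‖ ≤ M := by
    rw [Complex.norm_real]; exact abs_primitive_le hV t
  have hM0 : 0 ≤ M := (norm_nonneg _).trans hM
  have h1 : ‖p.1‖ ≤ ‖p‖ := norm_fst_le p
  have h2 : ‖p.2‖ ≤ ‖p‖ := norm_snd_le p
  have h3 : ‖p.2 + primitive V t * p.1‖ ≤ (1 + M) * ‖p‖ := by
    calc _ ≤ ‖p.2‖ + ‖(primitive V t : ℂ)‖ * ‖p.1‖ := by
          rw [← norm_mul]; exact norm_add_le _ _
      _ ≤ ‖p‖ + M * ‖p‖ := by gcongr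
      _ = _ := by ring
  have hz := norm_nonneg z
  have hp := norm_nonneg p
  rw [Prod.norm_def, max_le_iff]
  constructor
  · refine h3.trans (mul_le_mul_of_nonneg_right ?_ hp)
    nlinarith
  · calc _ ≤ ‖z‖ * ‖p.1‖ + ‖(primitive V t : ℂ)‖ * ‖p.2 + primitive V t * p.1‖ := by
          rw [← norm_mul, ← norm_mul, ← norm_neg (z * p.1)]; exact norm_sub_le _ _
      _ ≤ ‖z‖ * ‖p‖ + M * ((1 + M) * ‖p‖) := by gcongr
      _ ≤ _ := by nlinarith [mul_nonneg hM0 hp]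

lemma IsSolutionOn.hasDerivAt_quasi {V : ℝ → ℝ} (hV : Integrable V) {z : ℂ} {s : Set ℝ}
    (hs : IsOpen s) {u : ℝ → ℂ} (hu : IsSolutionOn V z s u) {x : ℝ} (hx : x ∈ s) :
    HasDerivAt (fun y => (u y, quasiDeriv V u y)) (quasiField V z x (u x, quasiDeriv V u x)) x := by
  refine ((hu.differentiable x hx).hasDerivAt.prodMk
    (hu.hasDerivAt_quasiDeriv hV hs hx)).congr_deriv ?_
  simp [quasiField, quasiDeriv]

/-- Solutions of the initial value problem are unique. -/
lemma IsSolutionOn.eqOn {V : ℝ → ℝ} (hV : Integrable V) {z : ℂ} {s : Set ℝ}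
    (hs : IsOpen s) (hs' : s.OrdConnected) {u w : ℝ → ℂ} (hu : IsSolutionOn V z s u)
    (hw : IsSolutionOn V z s w) {c : ℝ} (hc : c ∈ s) (h0 : u c = w c)
    (h1 : deriv u c = deriv w c) : EqOn u w s := by
  intro x hx
  obtain ⟨l, _, hl, hl'⟩ := exists_Ioo_Icc_subset hs (show min x c ∈ s by
    rcases min_choice x c with h | h <;> rwa [h])
  obtain ⟨_, r, hr, hr'⟩ := exists_Ioo_Icc_subset hs (show max x c ∈ s by
    rcases max_choice x c with h | h <;> rwa [h])
  have hsub : Ioo l r ⊆ s := fun y hy =>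
    hs'.out (hl' ⟨le_rfl, (hl.1.trans hl.2).le⟩) (hr' ⟨(hr.1.trans hr.2).le, le_rfl⟩)
      (Ioo_subset_Icc_self hy)
  have := ODE_solution_unique_of_mem_Ioo (v := quasiField V z) (s := fun _ => univ)
    (K := (((1 + ∫ t, |V t|) ^ 2 + ‖z‖).toNNReal)) (a := l) (b := r) (t₀ := c)
    (f := fun y => (u y, quasiDeriv V u y)) (g := fun y => (w y, quasiDeriv V w y))
    (fun t _ => (LipschitzWith.of_dist_le_mul fun p q => by
      rw [dist_eq_norm, quasiField_sub, dist_eq_norm]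
      refine (norm_quasiField_le hV z t _).trans ?_
      gcongr
      exact Real.le_coe_toNNReal _).lipschitzOnWith)
    ⟨hl.1.trans_le (min_le_right _ _), (le_max_right _ _).trans_lt hr.2⟩
    (fun t ht => ⟨hu.hasDerivAt_quasi hV hs (hsub ht), trivial⟩)
    (fun t ht => ⟨hw.hasDerivAt_quasi hV hs (hsub ht), trivial⟩)
    (by simp [quasiDeriv, h0, h1])
    ⟨hl.1.trans_le (min_le_left _ _), (le_max_left _ _).trans_lt hr.2⟩
  exact congrArg Prod.fst this

/-- The initial value problem has a solution on the whole line. -/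
lemma exists_isSolutionOn_univ {V : ℝ → ℝ} (hV : Integrable V) (z : ℂ) (c : ℝ) (p q : ℂ) :
    ∃ u : ℝ → ℂ, IsSolutionOn V z univ u ∧ u c = p ∧ deriv u c = q := by
  have hW : Continuous fun t => (primitive V t : ℂ) :=
    Complex.continuous_ofReal.comp (continuous_primitive hV)
  obtain ⟨F, hF0, hF⟩ := exists_global_solution (f := quasiField V z)
    (K := (1 + ∫ t, |V t|) ^ 2 + ‖z‖) (by
      have : 0 ≤ ∫ t, |V t| := integral_nonneg fun _ => abs_nonneg _
      positivity)
    (by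
      have h1 : Continuous fun p : ℝ × ℂ × ℂ => (primitive V p.1 : ℂ) := hW.comp continuous_fst
      unfold quasiField
      fun_prop)
    (fun t x y => by rw [quasiField_sub]; exact norm_quasiField_le hV z t _)
    -- The second component starts at the quasi-derivative, not at `q` itself.
    (fun t => by simp [quasiField]) c (p, q - primitive V c * p)
  have h1 : ∀ x, HasDerivAt (fun x => (F x).1) ((F x).2 + primitive V x * (F x).1) x :=
    fun x => (hF x).fst
  have h2 : ∀ x, HasDerivAt (fun x => (F x).2) (-(z * (F x).1) -
      primitive V x * ((F x).2 + primitive V x * (F x).1)) x := fun x => (hF x).snd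
  have hd : deriv (fun x => (F x).1) = fun x => (F x).2 + primitive V x • (F x).1 :=
    funext fun x => by rw [(h1 x).deriv, Complex.real_smul]
  have c1 : Continuous fun x => (F x).1 :=
    continuous_iff_continuousAt.2 fun x => (h1 x).continuousAt
  have c2 : Continuous fun x => (F x).2 :=
    continuous_iff_continuousAt.2 fun x => (h2 x).continuousAt
  refine ⟨fun x => (F x).1, ⟨fun x _ => (h1 x).differentiableAt, fun x y _ _ => ?_, ?_⟩, ?_, ?_⟩
  · rw [hd]
    refine AbsolutelyContinuousOnInterval.add (absolutelyContinuousOnInterval_of_hasDerivAt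
      (fun x _ => h2 x) (by fun_prop)) ?_
    exact (absolutelyContinuousOnInterval_primitive hV x y).fun_smul
      (absolutelyContinuousOnInterval_of_hasDerivAt (fun x _ => h1 x) (by fun_prop))
  · filter_upwards [ae_hasDerivAt_primitive hV] with x hx _
    rw [hd]
    refine ((h2 x).add (hx.smul (h1 x))).congr_deriv ?_
    simp only [Complex.real_smul]
    ring
  · simp [hF0]
  · rw [hd]; simp [hF0]

lemma IsSolutionOn.mono {V : ℝ → ℝ} {z : ℂ} {s t : Set ℝ} {u : ℝ → ℂ}
    (hu : IsSolutionOn V z s u) (h : t ⊆ s) : IsSolutionOn V z t u where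
  differentiable x hx := hu.differentiable x (h hx)
  absolutelyContinuous x y hxy hs := hu.absolutelyContinuous x y hxy (hs.trans h)
  equation := by filter_upwards [hu.equation] with x hx hxt using hx (h hxt)

lemma IsSolutionOn.congr {V : ℝ → ℝ} {z : ℂ} {s : Set ℝ} (hs : IsOpen s) {u w : ℝ → ℂ}
    (hu : IsSolutionOn V z s u) (h : EqOn u w s) : IsSolutionOn V z s w where
  differentiable x hx := (hu.differentiable x hx).congr_of_eventuallyEq
    (h.symm.eventuallyEq_of_mem (hs.mem_nhds hx))
  absolutelyContinuous x y hxy hxys :=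
    absolutelyContinuousOnInterval_of_dist_le (hu.absolutelyContinuous x y hxy hxys)
      fun c hc d hd => by
        rw [uIcc_of_le hxy] at hc hd
        rw [h.deriv hs (hxys hc), h.deriv hs (hxys hd)]
  equation := by
    filter_upwards [hu.equation] with x hx hxs
    rw [← h hxs]
    exact (hx hxs).congr_of_eventuallyEq
      ((h.deriv hs).symm.eventuallyEq_of_mem (hs.mem_nhds hxs))

/-- A solution on an open interval extends to the whole line. -/
lemma IsSolutionOn.exists_extension {V : ℝ → ℝ} (hV : Integrable V) {z : ℂ} {s : Set ℝ}
    (hs : IsOpen s) (hs' : s.OrdConnected) (hne : s.Nonempty) {u : ℝ → ℂ}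
    (hu : IsSolutionOn V z s u) : ∃ w : ℝ → ℂ, IsSolutionOn V z univ w ∧ EqOn u w s := by
  obtain ⟨c, hc⟩ := hne
  obtain ⟨w, hw, h0, h1⟩ := exists_isSolutionOn_univ hV z c (u c) (deriv u c)
  exact ⟨w, hw, hu.eqOn hV hs hs' (hw.mono (subset_univ _)) hc h0.symm h1.symm⟩

section Univ

variable {V : ℝ → ℝ} {z : ℂ} {u w : ℝ → ℂ}

lemma IsSolutionOn.hasDerivAt (hu : IsSolutionOn V z univ u) (x : ℝ) :
    HasDerivAt u (deriv u x) x := (hu.differentiable x trivial).hasDerivAt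

lemma IsSolutionOn.continuous (hu : IsSolutionOn V z univ u) : Continuous u :=
  continuousOn_univ.1 hu.continuousOn

lemma IsSolutionOn.continuous_deriv (hu : IsSolutionOn V z univ u) : Continuous (deriv u) :=
  continuousOn_univ.1 (hu.continuousOn_deriv isOpen_univ)

lemma IsSolutionOn.deriv_sub (hu : IsSolutionOn V z univ u) (hw : IsSolutionOn V z univ w)
    (x : ℝ) : deriv (u - w) x = deriv u x - deriv w x :=
  ((hu.hasDerivAt x).sub (hw.hasDerivAt x)).deriv

lemma IsSolutionOn.sub (hu : IsSolutionOn V z univ u) (hw : IsSolutionOn V z univ w) :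
    IsSolutionOn V z univ (u - w) := by
  have hd : deriv (u - w) = deriv u - deriv w := funext (hu.deriv_sub hw)
  refine ⟨fun x _ => ((hu.hasDerivAt x).sub (hw.hasDerivAt x)).differentiableAt,
    fun x y hxy hs => ?_, ?_⟩
  · rw [hd]
    exact (hu.absolutelyContinuous x y hxy hs).sub (hw.absolutelyContinuous x y hxy hs)
  · filter_upwards [hu.equation, hw.equation] with x hx hx' _
    rw [hd]
    refine ((hx trivial).sub (hx' trivial)).congr_deriv ?_
    simp only [Pi.sub_apply]
    ring

lemma IsSolutionOn.deriv_const_smul (hu : IsSolutionOn V z univ u) (k : ℂ) (x : ℝ) :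
    deriv (k • u) x = k * deriv u x :=
  ((hu.hasDerivAt x).const_smul k).deriv

lemma IsSolutionOn.const_smul (hu : IsSolutionOn V z univ u) (k : ℂ) :
    IsSolutionOn V z univ (k • u) := by
  have hd : deriv (k • u) = fun x => k • deriv u x := funext (hu.deriv_const_smul k)
  refine ⟨fun x _ => ((hu.hasDerivAt x).const_smul k).differentiableAt,
    fun x y hxy hs => ?_, ?_⟩
  · rw [hd]
    exact (hu.absolutelyContinuous x y hxy hs).const_smul k
  · filter_upwards [hu.equation] with x hx _
    rw [hd]
    refine ((hx trivial).const_smul k).congr_deriv ?_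
    simp only [Pi.smul_apply, smul_eq_mul]
    ring

end Univ

/-! ### Wronskian, flux and energy identities -/

section Wronskian

variable {V : ℝ → ℝ}

/-- Replacing derivatives by quasi-derivatives leaves the Wronskian unchanged, and these are
differentiable everywhere. -/
lemma IsSolutionOn.hasDerivAt_wronskian (hV : Integrable V) {z₁ z₂ : ℂ} {f g : ℝ → ℂ}
    (hf : IsSolutionOn V z₁ univ f) (hg : IsSolutionOn V z₂ univ g) (x : ℝ) :
    HasDerivAt (wronskian f g) ((z₁ - z₂) * (f x * g x)) x := by
  have h : wronskian f g = fun x => f x * quasiDeriv V g x - quasiDeriv V f x * g x := by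
    ext x; simp only [wronskian, quasiDeriv]; ring
  rw [h]
  refine (((hf.hasDerivAt x).mul (hg.hasDerivAt_quasiDeriv hV isOpen_univ trivial)).sub
    ((hf.hasDerivAt_quasiDeriv hV isOpen_univ trivial).mul (hg.hasDerivAt x))).congr_deriv ?_
  simp only [quasiDeriv]
  ring

lemma IsSolutionOn.wronskian_eq (hV : Integrable V) {z : ℂ} {f g : ℝ → ℂ}
    (hf : IsSolutionOn V z univ f) (hg : IsSolutionOn V z univ g) (x y : ℝ) :
    wronskian f g x = wronskian f g y := by
  have h := fun x => hf.hasDerivAt_wronskian hV hg x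
  exact is_const_of_deriv_eq_zero (fun x => (h x).differentiableAt)
    (fun x => by rw [(h x).deriv]; ring) x y

/-- The flux `Im (u' ū)` of a solution for a real spectral parameter is conserved. -/
lemma IsSolutionOn.flux_eq (hV : Integrable V) {e : ℝ} {u : ℝ → ℂ}
    (hu : IsSolutionOn V e univ u) (x y : ℝ) :
    (deriv u x * starRingEnd ℂ (u x)).im = (deriv u y * starRingEnd ℂ (u y)).im := by
  have h : ∀ x, HasDerivAt (fun x => quasiDeriv V u x * starRingEnd ℂ (u x))
      ((-(e * u x) - primitive V x * deriv u x) * starRingEnd ℂ (u x) +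
        quasiDeriv V u x * starRingEnd ℂ (deriv u x)) x := fun x =>
    (hu.hasDerivAt_quasiDeriv hV isOpen_univ trivial).mul (hu.hasDerivAt x).star
  have h' : ∀ x, HasDerivAt (fun x => (quasiDeriv V u x * starRingEnd ℂ (u x)).im) 0 x := by
    intro x
    refine (Complex.imCLM.hasFDerivAt.comp_hasDerivAt x (h x)).congr_deriv ?_
    simp [quasiDeriv]
    ring
  -- The primitive is real, so its contribution, a multiple of `|u|²`, has no imaginary part.
  have e1 : ∀ x, (deriv u x * starRingEnd ℂ (u x)).im =
      (quasiDeriv V u x * starRingEnd ℂ (u x)).im := fun x => by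
    simp [quasiDeriv]
    ring
  rw [e1, e1]
  exact is_const_of_deriv_eq_zero (fun x => (h' x).differentiableAt)
    (fun x => (h' x).deriv) x y

/-- Positivity of the energy form on nonzero solutions for the spectral parameter `0`. -/
lemma IsSolutionOn.re_deriv_mul_conj_lt (hV : Integrable V) {a b : ℝ} (hab : a < b)
    (hpos : IsPositiveDefiniteOn V a b) {u : ℝ → ℂ} (hu : IsSolutionOn V 0 univ u)
    {c : ℝ} (hc : c ∈ Icc a b) (huc : u c ≠ 0) :
    (deriv u a * starRingEnd ℂ (u a)).re < (deriv u b * starRingEnd ℂ (u b)).re := by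
  let p : ℝ → ℝ := fun x => (deriv u x).re * (u x).re + (deriv u x).im * (u x).im
  have hp : ∀ x, (deriv u x * starRingEnd ℂ (u x)).re = p x := fun x => by simp [p]
  have hacd := hu.absolutelyContinuous a b hab.le (subset_univ _)
  have hacu : AbsolutelyContinuousOnInterval u a b :=
    absolutelyContinuousOnInterval_of_hasDerivAt (fun x _ => hu.hasDerivAt x)
      hu.continuous_deriv.continuousOn
  have hre : ∀ f : ℝ → ℂ, AbsolutelyContinuousOnInterval f a b →
      AbsolutelyContinuousOnInterval (fun x => (f x).re) a b := fun f hf =>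
    absolutelyContinuousOnInterval_of_dist_le hf fun x _ y _ => by
      rw [Real.dist_eq, dist_eq_norm, ← Complex.sub_re]; exact Complex.abs_re_le_norm _
  have him : ∀ f : ℝ → ℂ, AbsolutelyContinuousOnInterval f a b →
      AbsolutelyContinuousOnInterval (fun x => (f x).im) a b := fun f hf =>
    absolutelyContinuousOnInterval_of_dist_le hf fun x _ y _ => by
      rw [Real.dist_eq, dist_eq_norm, ← Complex.sub_im]; exact Complex.abs_im_le_norm _
  have hacp : AbsolutelyContinuousOnInterval p a b :=
    ((hre _ hacd).fun_mul (hre _ hacu)).add ((him _ hacd).fun_mul (him _ hacu))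
  have hderiv : ∀ᵐ x, deriv p x = ‖deriv u x‖ ^ 2 + V x * ‖u x‖ ^ 2 := by
    filter_upwards [hu.equation] with x hx
    have h1 := hx trivial
    have h2 := hu.hasDerivAt x
    refine (((Complex.reCLM.hasFDerivAt.comp_hasDerivAt x h1).mul
      (Complex.reCLM.hasFDerivAt.comp_hasDerivAt x h2)).add
      ((Complex.imCLM.hasFDerivAt.comp_hasDerivAt x h1).mul
      (Complex.imCLM.hasFDerivAt.comp_hasDerivAt x h2))).deriv.trans ?_
    simp only [Complex.sq_norm, Complex.normSq_apply]
    simp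
    ring
  have hintV : IntervalIntegrable (fun x => V x * ‖u x‖ ^ 2) volume a b :=
    hV.intervalIntegrable.mul_continuousOn (hu.continuous.norm.pow 2).continuousOn
  have hintD : IntervalIntegrable (fun x => ‖deriv u x‖ ^ 2) volume a b :=
    (hu.continuous_deriv.norm.pow 2).intervalIntegrable _ _
  have hsum : p b - p a = (∫ x in a..b, ‖deriv u x‖ ^ 2) + ∫ x in a..b, V x * ‖u x‖ ^ 2 := by
    rw [← hacp.integral_deriv_eq_sub, ← intervalIntegral.integral_add hintD hintV]
    exact intervalIntegral.integral_congr_ae (hderiv.mono fun x hx _ => hx)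
  have h1 : 0 ≤ ∫ x in a..b, ‖deriv u x‖ ^ 2 :=
    intervalIntegral.integral_nonneg hab.le fun x _ => by positivity
  -- Positivity is tested on `L²(ℝ)`, so `u` is cut off to `[a, b]`.
  have hind : EqOn (fun x => V x * ‖(Icc a b).indicator u x‖ ^ 2)
      (fun x => V x * ‖u x‖ ^ 2) (Ioo a b) := fun x hx => by
    simp only [indicator_of_mem (Ioo_subset_Icc_self hx)]
  have h2 : 0 < ∫ x in Ioo a b, V x * ‖(Icc a b).indicator u x‖ ^ 2 := by
    refine hpos _ ?_ ?_ ?_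
    · rw [memLp_indicator_iff_restrict measurableSet_Icc]
      obtain ⟨C, hC⟩ := isCompact_Icc.exists_bound_of_continuousOn
        (hu.continuous.continuousOn (s := Icc a b))
      exact MemLp.of_bound hu.continuous.aestronglyMeasurable C
        ((ae_restrict_iff' measurableSet_Icc).2 (.of_forall hC))
    -- Vanishing almost everywhere on `(a, b)` would by continuity give `u = 0` on `[a, b]`, against
    -- `u c ≠ 0`.
    · intro h
      have h' : u =ᵐ[volume.restrict (Ioo a b)] fun _ => 0 := by
        filter_upwards [h, ae_restrict_mem measurableSet_Ioo] with x hx hx'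
        rwa [indicator_of_mem (Ioo_subset_Icc_self hx')] at hx
      have h3 := Measure.eqOn_open_of_ae_eq h' isOpen_Ioo hu.continuous.continuousOn
        continuousOn_const
      have h4 := h3.closure hu.continuous continuous_const
      rw [closure_Ioo hab.ne] at h4
      exact huc (h4 hc)
    · rw [integrableOn_congr_fun hind measurableSet_Ioo]
      exact ((intervalIntegrable_iff_integrableOn_Ioc_of_le hab.le).1 hintV).mono_set
        Ioo_subset_Ioc_self
  rw [setIntegral_congr_fun measurableSet_Ioo hind, ← integral_Ioc_eq_integral_Ioo,
    ← intervalIntegral.integral_of_le hab.le] at h2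
  rw [hp, hp]
  linarith

end Wronskian

/-! ### The Robin problem: a priori bounds and uniqueness -/

/-- Solutions of `-u'' + V u = κ² u` with Robin conditions at the ends of `[a, b]`. -/
structure IsRobinSolution (V : ℝ → ℝ) (a b κ : ℝ) (τ ca cb : ℂ) (u : ℝ → ℂ) : Prop where
  sol : IsSolutionOn V ((κ : ℂ) ^ 2) univ u
  left : deriv u a + Complex.I * κ * τ * u a = Complex.I * κ * ca
  right : deriv u b - Complex.I * κ * τ * u b = -(Complex.I * κ * cb)

namespace IsRobinSolution

variable {V : ℝ → ℝ} {a b κ : ℝ} {τ ca cb : ℂ} {u : ℝ → ℂ}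

lemma deriv_left (h : IsRobinSolution V a b κ τ ca cb u) :
    deriv u a = -(Complex.I * κ * (τ * u a - ca)) := by linear_combination h.left

lemma deriv_right (h : IsRobinSolution V a b κ τ ca cb u) :
    deriv u b = Complex.I * κ * (τ * u b - cb) := by linear_combination h.right

/-- Equality of the fluxes at `a` and `b`, with the derivatives replaced through the Robin
conditions and `κ` cancelled. -/
lemma energy_identity (hV : Integrable V) (hκ : 0 < κ) (h : IsRobinSolution V a b κ τ ca cb u) :
    τ.re * (‖u a‖ ^ 2 + ‖u b‖ ^ 2) =
      (ca * starRingEnd ℂ (u a)).re + (cb * starRingEnd ℂ (u b)).re := by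
  have hs := h.sol
  rw [← Complex.ofReal_pow] at hs
  have hf := hs.flux_eq hV a b
  rw [h.deriv_left, h.deriv_right] at hf
  rw [Complex.sq_norm, Complex.sq_norm, Complex.normSq_apply, Complex.normSq_apply]
  apply mul_left_cancel₀ hκ.ne'
  simp only [Complex.mul_re, Complex.conj_re, Complex.conj_im]
  simp at hf
  linear_combination -hf

lemma norm_le (hV : Integrable V) (hκ : 0 < κ) (hτ : 1 / 2 ≤ τ.re) (hca : ‖ca‖ ≤ 4)
    (hcb : ‖cb‖ ≤ 4) (h : IsRobinSolution V a b κ τ ca cb u) : ‖u a‖ ≤ 10 ∧ ‖u b‖ ≤ 10 := by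
  have h1 := h.energy_identity hV hκ
  have h2 : ∀ c w : ℂ, ‖c‖ ≤ 4 → (c * starRingEnd ℂ w).re ≤ 4 * ‖w‖ := fun c w hc => by
    refine (Complex.re_le_norm _).trans ?_
    rw [norm_mul, Complex.norm_conj]
    gcongr
  have h3 := h2 ca (u a) hca
  have h4 := h2 cb (u b) hcb
  have h5 : 1 / 2 * (‖u a‖ ^ 2 + ‖u b‖ ^ 2) ≤ τ.re * (‖u a‖ ^ 2 + ‖u b‖ ^ 2) := by gcongr
  -- The estimates add up to `(‖u a‖ - 4)² + (‖u b‖ - 4)² ≤ 32`, and `4 + √32 < 10`.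
  constructor <;> nlinarith [sq_nonneg (‖u a‖ - 4), sq_nonneg (‖u b‖ - 4)]

lemma norm_deriv_le (hV : Integrable V) (hκ : 0 < κ) (hτ : 1 / 2 ≤ τ.re) (hτ' : ‖τ‖ ≤ 2)
    (hca : ‖ca‖ ≤ 4) (hcb : ‖cb‖ ≤ 4) (h : IsRobinSolution V a b κ τ ca cb u) :
    ‖deriv u a‖ ≤ 24 * κ ∧ ‖deriv u b‖ ≤ 24 * κ := by
  obtain ⟨ha, hb⟩ := h.norm_le hV hκ hτ hca hcb
  have key : ∀ w c : ℂ, ‖w‖ ≤ 10 → ‖c‖ ≤ 4 → ‖Complex.I * κ * (τ * w - c)‖ ≤ 24 * κ := by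
    intro w c hw hc
    rw [norm_mul, norm_mul, Complex.norm_I, Complex.norm_real, Real.norm_of_nonneg hκ.le, one_mul,
      mul_comm]
    gcongr
    calc _ ≤ ‖τ‖ * ‖w‖ + ‖c‖ := by rw [← norm_mul]; exact norm_sub_le _ _
      _ ≤ 2 * 10 + 4 := by gcongr
      _ = 24 := by norm_num
  rw [h.deriv_left, h.deriv_right, norm_neg]
  exact ⟨key _ _ ha hca, key _ _ hb hcb⟩

/-- The homogeneous Robin problem has only the trivial solution. -/
lemma eq_zero (hV : Integrable V) (hab : a < b) (hpos : IsPositiveDefiniteOn V a b) (hκ : 0 ≤ κ)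
    (hτ : 1 / 2 ≤ τ.re) (h : IsRobinSolution V a b κ τ 0 0 u) :
    u a = 0 ∧ u b = 0 ∧ deriv u a = 0 ∧ deriv u b = 0 := by
  suffices hu : u a = 0 ∧ u b = 0 by
    refine ⟨hu.1, hu.2, ?_, ?_⟩
    · rw [h.deriv_left, hu.1]; simp
    · rw [h.deriv_right, hu.2]; simp
  -- At `κ = 0` the flux carries no information; the conditions are Neumann conditions, and the
  -- energy form of a nonzero solution would have to increase strictly from `0` to `0`.
  rcases hκ.eq_or_lt with rfl | hκ
  · have hs := h.sol
    have ha := h.deriv_left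
    have hb := h.deriv_right
    simp only [Complex.ofReal_zero, mul_zero, zero_mul, neg_zero] at ha hb
    rw [Complex.ofReal_zero, zero_pow two_ne_zero] at hs
    have key : ∀ c ∈ Icc a b, u c = 0 := fun c hc => by
      by_contra hne
      have := hs.re_deriv_mul_conj_lt hV hab hpos hc hne
      simp [ha, hb] at this
    exact ⟨key a ⟨le_rfl, hab.le⟩, key b ⟨hab.le, le_rfl⟩⟩
  · have h1 := h.energy_identity hV hκ
    simp only [zero_mul, Complex.zero_re, add_zero] at h1
    have h2 : ‖u a‖ ^ 2 + ‖u b‖ ^ 2 = 0 := by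
      rcases mul_eq_zero.1 h1 with h | h
      · linarith
      · exact h
    constructor <;> rw [← norm_eq_zero] <;> nlinarith [norm_nonneg (u a), norm_nonneg (u b)]

lemma sub {ca' cb' : ℂ} {w : ℝ → ℂ} (h : IsRobinSolution V a b κ τ ca cb u)
    (h' : IsRobinSolution V a b κ τ ca' cb' w) :
    IsRobinSolution V a b κ τ (ca - ca') (cb - cb') (u - w) where
  sol := h.sol.sub h'.sol
  left := by
    rw [h.sol.deriv_sub h'.sol, Pi.sub_apply]
    linear_combination h.left - h'.left
  right := by
    rw [h.sol.deriv_sub h'.sol, Pi.sub_apply]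
    linear_combination h.right - h'.right

end IsRobinSolution

/-- The Wronskian has derivative `κ² u φ`. Grönwall's inequality bounds `u` on `[a, b]` from its
data at `a`, uniformly for `κ ≤ 1`, and `κ² ≤ κ`. -/
lemma exists_wronskian_bound {V : ℝ → ℝ} (hV : Integrable V) {a b : ℝ} (hab : a < b)
    {φ : ℝ → ℂ} (hφ : IsSolutionOn V 0 univ φ) :
    ∃ C : ℝ, ∀ (κ : ℝ) (τ ca cb : ℂ) (u : ℝ → ℂ), 0 < κ → κ ≤ 1 → 1 / 2 ≤ τ.re → ‖τ‖ ≤ 2 →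
      ‖ca‖ ≤ 4 → ‖cb‖ ≤ 4 → IsRobinSolution V a b κ τ ca cb u →
      ‖wronskian u φ b - wronskian u φ a‖ ≤ C * κ := by
  obtain ⟨Φ, hΦ⟩ := isCompact_Icc.exists_bound_of_continuousOn
    (hφ.continuous.continuousOn (s := Icc a b))
  have hΦ0 : 0 ≤ Φ := (norm_nonneg _).trans (hΦ a ⟨le_rfl, hab.le⟩)
  set M := ∫ t, |V t|
  have hM0 : 0 ≤ M := integral_nonneg fun _ => abs_nonneg _
  let L := (1 + M) ^ 2 + 1
  -- `24 + 10 M` bounds the initial pair `(u, u' - W u)` at `a`, where `W` is the primitive of `V`;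
  -- `L` is the Lipschitz constant for `κ ≤ 1`.
  let S := (24 + M * 10) * Real.exp (L * (b - a))
  refine ⟨S * Φ * (b - a), fun κ τ ca cb u hκ hκ1 hτ hτ' hca hcb h => ?_⟩
  have hz : ‖(κ : ℂ) ^ 2‖ ≤ κ := by
    rw [norm_pow, Complex.norm_real, Real.norm_of_nonneg hκ.le]; nlinarith
  obtain ⟨hua, -⟩ := h.norm_le hV hκ hτ hca hcb
  obtain ⟨hda, -⟩ := h.norm_deriv_le hV hκ hτ hτ' hca hcb
  have hS : ∀ x ∈ Icc a b, ‖u x‖ ≤ S := by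
    intro x hx
    have hd := fun y => h.sol.hasDerivAt_quasi hV isOpen_univ (mem_univ y)
    have := norm_le_gronwallBound_of_norm_deriv_right_le (a := a) (b := b)
      (δ := 24 + M * 10) (K := L) (ε := 0)
      (HasDerivAt.continuousOn fun y _ => hd y) (fun y _ => (hd y).hasDerivWithinAt)
      (by
        rw [Prod.norm_def, max_le_iff]
        constructor
        · dsimp only
          linarith
        · refine (norm_sub_le _ _).trans ?_
          rw [norm_mul, Complex.norm_real]
          have := abs_primitive_le hV a
          rw [← Real.norm_eq_abs] at this
          refine add_le_add (by linarith) ?_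
          gcongr)
      (fun y _ => by
        rw [add_zero]
        refine (norm_quasiField_le hV _ y _).trans ?_
        gcongr
        linarith) x hx
    rw [gronwallBound_ε0] at this
    refine (norm_fst_le (u x, quasiDeriv V u x)).trans (this.trans ?_)
    have h1 := hx.2
    have hL : 0 ≤ L := by positivity
    change _ ≤ (24 + M * 10) * Real.exp (L * (b - a))
    gcongr
  have hS0 : 0 ≤ S := by positivity
  have := Convex.norm_image_sub_le_of_norm_hasDerivWithin_le (s := Icc a b)
    (fun x _ => (h.sol.hasDerivAt_wronskian hV hφ x).hasDerivWithinAt) (C := κ * (S * Φ))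
    (fun x hx => by
      rw [norm_mul, norm_mul, sub_zero]
      have := hS x hx
      have := hΦ x hx
      gcongr) (convex_Icc a b) (left_mem_Icc.2 hab.le) (right_mem_Icc.2 hab.le)
  rw [Real.norm_of_nonneg (sub_nonneg.2 hab.le)] at this
  exact this.trans (le_of_eq (by ring))

/-- Uniform bounds for the boundary values of solutions of the Robin problem. -/
lemma exists_robin_bound {V : ℝ → ℝ} (hV : Integrable V) {a b : ℝ} (hab : a < b)
    (hpos : IsPositiveDefiniteOn V a b) :
    ∃ C : ℝ, 0 ≤ C ∧ ∀ (κ : ℝ) (τ ca cb : ℂ) (u : ℝ → ℂ), 0 < κ → 1 / 2 ≤ τ.re → ‖τ‖ ≤ 2 →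
      ‖ca‖ ≤ 4 → ‖cb‖ ≤ 4 → IsRobinSolution V a b κ τ ca cb u →
      ‖u a‖ ≤ C * (κ / (1 + κ)) ∧ ‖u b‖ ≤ C * (κ / (1 + κ)) := by
  -- Zero-energy solutions with Neumann data at one end. Positivity makes the derivative at the
  -- other end nonzero, so a Wronskian isolates the value of `u` there.
  obtain ⟨φ, hφ, hφ0, hφ1⟩ := exists_isSolutionOn_univ hV 0 a 1 0
  obtain ⟨χ, hχ, hχ0, hχ1⟩ := exists_isSolutionOn_univ hV 0 b 1 0
  have hφb : deriv φ b ≠ 0 := fun h0 => by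
    have := hφ.re_deriv_mul_conj_lt hV hab hpos (left_mem_Icc.2 hab.le) (by simp [hφ0])
    simp [hφ1, h0] at this
  have hχa : deriv χ a ≠ 0 := fun h0 => by
    have := hχ.re_deriv_mul_conj_lt hV hab hpos (right_mem_Icc.2 hab.le) (by simp [hχ0])
    simp [hχ1, h0] at this
  obtain ⟨C₁, hC₁⟩ := exists_wronskian_bound hV hab hφ
  obtain ⟨C₂, hC₂⟩ := exists_wronskian_bound hV hab hχ
  let D₁ := (C₁ + 24 * ‖φ b‖ + 24) / ‖deriv φ b‖
  let D₂ := (C₂ + 24 * ‖χ a‖ + 24) / ‖deriv χ a‖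
  let D := max 10 (max D₁ D₂)
  refine ⟨2 * D, by positivity, fun κ τ ca cb u hκ hτ hτ' hca hcb h => ?_⟩
  obtain ⟨hua, hub⟩ := h.norm_le hV hκ hτ hca hcb
  obtain ⟨hda, hdb⟩ := h.norm_deriv_le hV hκ hτ hτ' hca hcb
  have hD10 : 10 ≤ D := le_max_left _ _
  have hD1 : D₁ ≤ D := (le_max_left _ _).trans (le_max_right _ _)
  have hD2 : D₂ ≤ D := (le_max_right _ _).trans (le_max_right _ _)
  -- For `κ ≤ 1` the Wronskian bound gives `O(κ)`; for `κ ≥ 1` the flux bound `10` suffices.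
  rcases le_total κ 1 with hκ1 | hκ1
  · have hfrac : κ ≤ 2 * (κ / (1 + κ)) := by
      rw [← mul_div_assoc, le_div_iff₀ (by positivity)]
      nlinarith
    have hgoal : D * κ ≤ 2 * D * (κ / (1 + κ)) := by nlinarith
    constructor
    · have hw := hC₂ κ τ ca cb u hκ hκ1 hτ hτ' hca hcb h
      have e : u a * deriv χ a =
          -(wronskian u χ b - wronskian u χ a) + deriv u a * χ a - deriv u b := by
        simp only [wronskian, hχ0, hχ1]; ring
      have h1 : ‖u a‖ * ‖deriv χ a‖ ≤ C₂ * κ + 24 * κ * ‖χ a‖ + 24 * κ := by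
        rw [← norm_mul, e]
        refine (norm_sub_le _ _).trans (add_le_add ((norm_add_le _ _).trans
          (add_le_add (by rwa [norm_neg]) ?_)) hdb)
        rw [norm_mul]; gcongr
      have h2 : ‖u a‖ ≤ D₂ * κ := by
        rw [div_mul_eq_mul_div, le_div_iff₀ (norm_pos_iff.2 hχa)]
        linarith
      exact h2.trans (le_trans (by gcongr) hgoal)
    · have hw := hC₁ κ τ ca cb u hκ hκ1 hτ hτ' hca hcb h
      have e : u b * deriv φ b =
          (wronskian u φ b - wronskian u φ a) + deriv u b * φ b - deriv u a := by
        simp only [wronskian, hφ0, hφ1]; ring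
      have h1 : ‖u b‖ * ‖deriv φ b‖ ≤ C₁ * κ + 24 * κ * ‖φ b‖ + 24 * κ := by
        rw [← norm_mul, e]
        refine (norm_sub_le _ _).trans (add_le_add ((norm_add_le _ _).trans
          (add_le_add hw ?_)) hda)
        rw [norm_mul]; gcongr
      have h2 : ‖u b‖ ≤ D₁ * κ := by
        rw [div_mul_eq_mul_div, le_div_iff₀ (norm_pos_iff.2 hφb)]
        linarith
      exact h2.trans (le_trans (by gcongr) hgoal)
  · have hfrac : 1 ≤ 2 * (κ / (1 + κ)) := by
      rw [← mul_div_assoc, le_div_iff₀ (by positivity)]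
      linarith
    have hgoal : 10 ≤ 2 * D * (κ / (1 + κ)) := by nlinarith
    exact ⟨hua.trans hgoal, hub.trans hgoal⟩

/-! ### Plane waves and Jost solutions -/

lemma ae_eq_zero_of_notMem_essSupport {V : ℝ → ℝ} (hV : Integrable V) :
    ∀ᵐ x, x ∉ essSupport V → V x = 0 := by
  have h := (ae_withDensity_iff' hV.aestronglyMeasurable.enorm).1
    (Measure.support_mem_ae (μ := volume.withDensity fun x => ‖V x‖ₑ))
  filter_upwards [h] with x hx hx'
  by_contra hne
  exact hx' (hx (by simpa using hne))

/-- The superposition `p exp (c x) + q exp (-c x)`. -/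
def planeWave (c p q : ℂ) (x : ℝ) : ℂ := p * Complex.exp (c * x) + q * Complex.exp (-(c * x))

lemma hasDerivAt_planeWave (c p q : ℂ) (x : ℝ) :
    HasDerivAt (planeWave c p q) (c * planeWave c p (-q) x) x := by
  have h : HasDerivAt (fun x : ℝ => c * (x : ℂ)) c x := by
    simpa using (Complex.ofRealCLM.hasDerivAt (x := x)).const_mul c
  refine ((h.cexp.const_mul p).add (h.neg.cexp.const_mul q)).congr_deriv ?_
  simp only [planeWave, Pi.neg_apply]
  ring

lemma deriv_planeWave (c p q : ℂ) : deriv (planeWave c p q) = c • planeWave c p (-q) :=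
  funext fun x => (hasDerivAt_planeWave c p q x).deriv

lemma continuous_planeWave (c p q : ℂ) : Continuous (planeWave c p q) :=
  continuous_iff_continuousAt.2 fun x => (hasDerivAt_planeWave c p q x).continuousAt

lemma continuous_deriv_planeWave (c p q : ℂ) : Continuous (deriv (planeWave c p q)) := by
  rw [deriv_planeWave]
  exact (continuous_planeWave c p (-q)).const_smul c

lemma isSolutionOn_planeWave {V : ℝ → ℝ} {s : Set ℝ} (hs : ∀ᵐ x, x ∈ s → V x = 0) {c z : ℂ}
    (hc : c ^ 2 = -z) (p q : ℂ) : IsSolutionOn V z s (planeWave c p q) := by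
  have h : ∀ x, HasDerivAt (deriv (planeWave c p q)) (c * (c * planeWave c p q x)) x := fun x => by
    rw [deriv_planeWave]
    simpa using (hasDerivAt_planeWave c p (-q) x).const_smul c
  refine ⟨fun x _ => (hasDerivAt_planeWave c p q x).differentiableAt, fun x y _ _ => ?_, ?_⟩
  · exact absolutelyContinuousOnInterval_of_hasDerivAt (fun x _ => h x)
      (((continuous_planeWave c p q).const_smul c).const_smul c).continuousOn
  · filter_upwards [hs] with x hx hxs
    refine (h x).congr_deriv ?_
    rw [hx hxs, Complex.ofReal_zero]
    linear_combination planeWave c p q x * hc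

lemma I_mul_sq (ζ : ℂ) : (Complex.I * ζ) ^ 2 = -ζ ^ 2 := by
  rw [mul_pow, Complex.I_sq]; ring

section Jost

variable {V : ℝ → ℝ} {a b : ℝ}

lemma ae_eq_zero_Ioi (hV : Integrable V) (hsupp : essSupport V = Icc a b) :
    ∀ᵐ x, x ∈ Ioi b → V x = 0 := by
  filter_upwards [ae_eq_zero_of_notMem_essSupport hV] with x hx hxb
  exact hx (by rw [hsupp]; exact fun h => (not_le.2 hxb) h.2)

lemma ae_eq_zero_Iio (hV : Integrable V) (hsupp : essSupport V = Icc a b) :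
    ∀ᵐ x, x ∈ Iio a → V x = 0 := by
  filter_upwards [ae_eq_zero_of_notMem_essSupport hV] with x hx hxa
  exact hx (by rw [hsupp]; exact fun h => (not_le.2 hxa) h.1)

/-- The plane wave solves the equation on `(b, ∞)`, where `V` vanishes almost everywhere, and
extends to the line; hence the choice defining `jostPlus` is not vacuous. -/
lemma jostPlus_spec (hV : Integrable V) (hsupp : essSupport V = Icc a b) (ζ : ℂ) :
    IsSolutionOn V (ζ ^ 2) univ (jostPlus V b ζ) ∧
      EqOn (jostPlus V b ζ) (planeWave (Complex.I * ζ) 1 0) (Ioi b) := by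
  obtain ⟨w, hw, hw'⟩ := (isSolutionOn_planeWave (ae_eq_zero_Ioi hV hsupp) (I_mul_sq ζ)
    1 0).exists_extension hV isOpen_Ioi ordConnected_Ioi nonempty_Ioi
  have h : IsSolutionOn V (ζ ^ 2) univ w ∧ ∀ x : ℝ, b < x → w x = Complex.exp (Complex.I * ζ * x) :=
    ⟨hw, fun x hx => by rw [← hw' hx]; simp [planeWave]⟩
  have h2 := Classical.epsilon_spec (p := fun u : ℝ → ℂ =>
    IsSolutionOn V (ζ ^ 2) univ u ∧ ∀ x : ℝ, b < x → u x = Complex.exp (Complex.I * ζ * x)) ⟨w, h⟩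
  exact ⟨h2.1, fun x hx => (h2.2 x hx).trans (by simp [planeWave])⟩

lemma jostMinus_spec (hV : Integrable V) (hsupp : essSupport V = Icc a b) (ζ : ℂ) :
    IsSolutionOn V (ζ ^ 2) univ (jostMinus V a ζ) ∧
      EqOn (jostMinus V a ζ) (planeWave (Complex.I * ζ) 0 1) (Iio a) := by
  obtain ⟨w, hw, hw'⟩ := (isSolutionOn_planeWave (ae_eq_zero_Iio hV hsupp) (I_mul_sq ζ)
    0 1).exists_extension hV isOpen_Iio ordConnected_Iio nonempty_Iio
  have h : IsSolutionOn V (ζ ^ 2) univ w ∧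
      ∀ x : ℝ, x < a → w x = Complex.exp (-(Complex.I * ζ * x)) :=
    ⟨hw, fun x hx => by rw [← hw' hx]; simp [planeWave]⟩
  have h2 := Classical.epsilon_spec (p := fun u : ℝ → ℂ =>
    IsSolutionOn V (ζ ^ 2) univ u ∧
      ∀ x : ℝ, x < a → u x = Complex.exp (-(Complex.I * ζ * x))) ⟨w, h⟩
  exact ⟨h2.1, fun x hx => (h2.2 x hx).trans (by simp [planeWave])⟩

lemma jostPlus_apply (hV : Integrable V) (hsupp : essSupport V = Icc a b) (ζ : ℂ) :
    jostPlus V b ζ b = Complex.exp (Complex.I * ζ * b) ∧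
      deriv (jostPlus V b ζ) b = Complex.I * ζ * Complex.exp (Complex.I * ζ * b) := by
  obtain ⟨h1, h2⟩ := jostPlus_spec hV hsupp ζ
  have hb : b ∈ closure (Ioi b) := by simp
  have e1 := h2.closure h1.continuous (continuous_planeWave _ _ _) hb
  have e2 := (h2.deriv isOpen_Ioi).closure h1.continuous_deriv
    (continuous_deriv_planeWave _ _ _) hb
  rw [deriv_planeWave] at e2
  exact ⟨by simpa [planeWave] using e1, by simpa [planeWave] using e2⟩

lemma jostMinus_apply (hV : Integrable V) (hsupp : essSupport V = Icc a b) (ζ : ℂ) :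
    jostMinus V a ζ a = Complex.exp (-(Complex.I * ζ * a)) ∧
      deriv (jostMinus V a ζ) a = -(Complex.I * ζ * Complex.exp (-(Complex.I * ζ * a))) := by
  obtain ⟨h1, h2⟩ := jostMinus_spec hV hsupp ζ
  have ha : a ∈ closure (Iio a) := by simp
  have e1 := h2.closure h1.continuous (continuous_planeWave _ _ _) ha
  have e2 := (h2.deriv isOpen_Iio).closure h1.continuous_deriv
    (continuous_deriv_planeWave _ _ _) ha
  rw [deriv_planeWave] at e2
  exact ⟨by simpa [planeWave] using e1, by simpa [planeWave] using e2⟩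

/-- At a zero, `χ₊` would also satisfy the condition of `χ₋` at `a`, hence solve the homogeneous
Robin problem with `τ = 1`; but `χ₊(b) ≠ 0`. -/
lemma jostFunction_ne_zero (hV : Integrable V) (hab : a < b) (hsupp : essSupport V = Icc a b)
    (hpos : IsPositiveDefiniteOn V a b) {κ : ℝ} (hκ : 0 ≤ κ) : jostFunction V a b κ ≠ 0 := by
  intro h0
  obtain ⟨hp1, hp2⟩ := jostPlus_apply hV hsupp κ
  obtain ⟨hm1, hm2⟩ := jostMinus_apply hV hsupp κ
  have hrobin : IsRobinSolution V a b κ 1 0 0 (jostPlus V b κ) := by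
    refine ⟨(jostPlus_spec hV hsupp κ).1, ?_, ?_⟩
    · rw [jostFunction, wronskian, hm1, hm2] at h0
      apply mul_left_cancel₀ (Complex.exp_ne_zero (-(Complex.I * κ * a)))
      linear_combination -h0
    · rw [hp1, hp2]; ring
  have := (hrobin.eq_zero hV hab hpos hκ (by norm_num)).2.1
  rw [hp1] at this
  exact Complex.exp_ne_zero _ this

end Jost

/-! ### Reduction of generalized eigenfunctions to their interior parts -/

/-- The amplitude of the wave coming in from the left. -/
def incomingLeft (k : ℝ) : ℂ := if 0 ≤ k then 1 else 0

/-- The amplitude of the wave coming in from the right. -/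
def incomingRight (k : ℝ) : ℂ := if 0 ≤ k then 0 else 1

lemma norm_incomingLeft_le (k : ℝ) : ‖incomingLeft k‖ ≤ 1 := by
  unfold incomingLeft; split_ifs <;> simp

lemma norm_incomingRight_le (k : ℝ) : ‖incomingRight k‖ ≤ 1 := by
  unfold incomingRight; split_ifs <;> simp

/-- With `|k|` in the exponent both signs of `k` take one form: `(A, B)` is `(R, T)` for `k ≥ 0` and
`(T, R)` for `k < 0`. -/
lemma exteriorConditions_iff {a b k : ℝ} {u : ℝ → ℂ} :
    ExteriorConditions a b k u ↔ ∃ A B : ℂ,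
      EqOn u (planeWave (Complex.I * |k|) (incomingLeft k) A) (Iio a) ∧
      EqOn u (planeWave (Complex.I * |k|) B (incomingRight k)) (Ioi b) := by
  unfold ExteriorConditions EqOn planeWave incomingLeft incomingRight
  rcases le_or_gt 0 k with hk | hk
  · simp [hk, abs_of_nonneg hk, not_lt.2 hk]
  · rw [exists_comm]
    simp [hk, abs_of_neg hk, not_le.2 hk, add_comm]

/-- `u` is the restriction to `(a, b)` of a generalized eigenfunction, with outgoing amplitudes
`A` at the left and `B` at the right. -/
structure IsInteriorPart (V : ℝ → ℝ) (a b k : ℝ) (θ₁ θ₂ : ℂ) (u : ℝ → ℂ) (A B : ℂ) : Prop where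
  sol : IsSolutionOn V ((|k| : ℝ) ^ 2 : ℂ) univ u
  right : Complex.exp (-θ₁ / 2) * planeWave (Complex.I * |k|) B (incomingRight k) b = u b
  right_deriv : Complex.exp (-θ₂ / 2) *
    deriv (planeWave (Complex.I * |k|) B (incomingRight k)) b = deriv u b
  left : Complex.exp (-θ₁ / 2) * planeWave (Complex.I * |k|) (incomingLeft k) A a = u a
  left_deriv : Complex.exp (-θ₂ / 2) *
    deriv (planeWave (Complex.I * |k|) (incomingLeft k) A) a = deriv u a

lemma ofReal_abs_sq (k : ℝ) : ((|k| : ℝ) ^ 2 : ℂ) = (k : ℂ) ^ 2 := by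
  rw [← Complex.ofReal_pow, sq_abs, Complex.ofReal_pow]

lemma tendsto_of_eventuallyEq_continuous {f g : ℝ → ℂ} {l : Filter ℝ} {x : ℝ}
    (hl : l ≤ 𝓝 x) (hfg : f =ᶠ[l] g) (hg : Continuous g) : Tendsto f l (𝓝 (g x)) :=
  ((hg.tendsto x).mono_left hl).congr' hfg.symm

lemma eq_of_tendsto_of_eventuallyEq {f g : ℝ → ℂ} {l : Filter ℝ} [l.NeBot] {x : ℝ} {y : ℂ}
    (hl : l ≤ 𝓝 x) (hf : Tendsto f l (𝓝 y)) (hfg : f =ᶠ[l] g) (hg : Continuous g) : y = g x :=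
  tendsto_nhds_unique hf (tendsto_of_eventuallyEq_continuous hl hfg hg)

/-- Each of the three pieces agrees with a function on the line that is continuous together with its
derivative, so the one-sided limits are point values of these. -/
lemma IsGenEigenfunction.exists_interiorPart {V : ℝ → ℝ} (hV : Integrable V) {a b : ℝ}
    (hab : a < b) {k : ℝ} {θ₁ θ₂ : ℂ} {ψ : ℝ → ℂ}
    (h : IsGenEigenfunction V a b k θ₁ θ₂ ψ) :
    ∃ (u : ℝ → ℂ) (A B : ℂ), IsInteriorPart V a b k θ₁ θ₂ u A B ∧ EqOn ψ u (Ioo a b) ∧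
      EqOn ψ (planeWave (Complex.I * |k|) (incomingLeft k) A) (Iio a) ∧
      EqOn ψ (planeWave (Complex.I * |k|) B (incomingRight k)) (Ioi b) := by
  obtain ⟨A, B, hA, hB⟩ := exteriorConditions_iff.1 h.exterior
  have hsub : Ioo a b ⊆ ({a, b} : Set ℝ)ᶜ := fun x hx hx' => by
    rcases hx' with rfl | rfl
    · exact lt_irrefl _ hx.1
    · exact lt_irrefl _ hx.2
  obtain ⟨u, hu, hψu⟩ := (h.solution.mono hsub).exists_extension hV isOpen_Ioo ordConnected_Ioo
    (nonempty_Ioo.2 hab)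
  obtain ⟨ubr, ubl, dbr, dbl, ual, uar, dal, dar, t1, t2, t3, t4, t5, t6, t7, t8, e1, e2, e3, e4⟩ :=
    h.interface
  have n1 : Ioi b ∈ 𝓝[>] b := self_mem_nhdsWithin
  have n2 : Ioo a b ∈ 𝓝[<] b := Ioo_mem_nhdsLT hab
  have n3 : Iio a ∈ 𝓝[<] a := self_mem_nhdsWithin
  have n4 : Ioo a b ∈ 𝓝[>] a := Ioo_mem_nhdsGT hab
  have hdu := hψu.deriv isOpen_Ioo
  have i1 := eq_of_tendsto_of_eventuallyEq nhdsWithin_le_nhds t1 (hB.eventuallyEq_of_mem n1)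
    (continuous_planeWave _ _ _)
  have i2 := eq_of_tendsto_of_eventuallyEq nhdsWithin_le_nhds t2 (hψu.eventuallyEq_of_mem n2)
    hu.continuous
  have i3 := eq_of_tendsto_of_eventuallyEq nhdsWithin_le_nhds t3
    ((hB.deriv isOpen_Ioi).eventuallyEq_of_mem n1) (continuous_deriv_planeWave _ _ _)
  have i4 := eq_of_tendsto_of_eventuallyEq nhdsWithin_le_nhds t4 (hdu.eventuallyEq_of_mem n2)
    hu.continuous_deriv
  have i5 := eq_of_tendsto_of_eventuallyEq nhdsWithin_le_nhds t5 (hA.eventuallyEq_of_mem n3)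
    (continuous_planeWave _ _ _)
  have i6 := eq_of_tendsto_of_eventuallyEq nhdsWithin_le_nhds t6 (hψu.eventuallyEq_of_mem n4)
    hu.continuous
  have i7 := eq_of_tendsto_of_eventuallyEq nhdsWithin_le_nhds t7
    ((hA.deriv isOpen_Iio).eventuallyEq_of_mem n3) (continuous_deriv_planeWave _ _ _)
  have i8 := eq_of_tendsto_of_eventuallyEq nhdsWithin_le_nhds t8 (hdu.eventuallyEq_of_mem n4)
    hu.continuous_deriv
  subst i1 i2 i3 i4 i5 i6 i7 i8
  exact ⟨u, A, B, ⟨by rwa [ofReal_abs_sq], e1, e2, e3, e4⟩, hψu, hA, hB⟩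

lemma isSolutionOn_compl_pair {V : ℝ → ℝ} {z : ℂ} {a b : ℝ} {u : ℝ → ℂ}
    (h₁ : IsSolutionOn V z (Iio a) u) (h₂ : IsSolutionOn V z (Ioo a b) u)
    (h₃ : IsSolutionOn V z (Ioi b) u) : IsSolutionOn V z {a, b}ᶜ u := by
  have hcases : ∀ x ∈ ({a, b} : Set ℝ)ᶜ, x ∈ Iio a ∨ x ∈ Ioo a b ∨ x ∈ Ioi b := by
    intro x hx
    simp only [mem_compl_iff, mem_insert_iff, mem_singleton_iff, not_or] at hx
    rcases lt_or_gt_of_ne hx.1 with h | h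
    · exact .inl h
    · rcases lt_or_gt_of_ne hx.2 with h' | h'
      · exact .inr (.inl ⟨h, h'⟩)
      · exact .inr (.inr h')
  refine ⟨fun x hx => ?_, fun x y hxy hs => ?_, ?_⟩
  · rcases hcases x hx with h | h | h
    exacts [h₁.differentiable x h, h₂.differentiable x h, h₃.differentiable x h]
  · have ha : a ∉ Icc x y := fun h => hs h (by simp)
    have hb : b ∉ Icc x y := fun h => hs h (by simp)
    rcases hcases x (hs (left_mem_Icc.2 hxy)) with h | h | h
    · refine h₁.absolutelyContinuous x y hxy fun t ht => ?_
      exact ht.2.trans_lt (not_le.1 fun h' => ha ⟨le_of_lt h, h'⟩)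
    · refine h₂.absolutelyContinuous x y hxy fun t ht => ⟨h.1.trans_le ht.1, ?_⟩
      exact ht.2.trans_lt (not_le.1 fun h' => hb ⟨h.2.le, h'⟩)
    · exact h₃.absolutelyContinuous x y hxy fun t ht => lt_of_lt_of_le h ht.1
  · filter_upwards [h₁.equation, h₂.equation, h₃.equation] with x e₁ e₂ e₃ hx
    rcases hcases x hx with h | h | h
    exacts [e₁ h, e₂ h, e₃ h]

lemma IsInteriorPart.exists_genEigenfunction {V : ℝ → ℝ} (hV : Integrable V) {a b : ℝ}
    (hab : a < b) (hsupp : essSupport V = Icc a b) {k : ℝ} {θ₁ θ₂ : ℂ} {u : ℝ → ℂ} {A B : ℂ}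
    (h : IsInteriorPart V a b k θ₁ θ₂ u A B) :
    ∃ ψ : ℝ → ℂ, IsGenEigenfunction V a b k θ₁ θ₂ ψ := by
  let ψ : ℝ → ℂ := fun x => if x < a then planeWave (Complex.I * |k|) (incomingLeft k) A x
    else if x < b then u x else planeWave (Complex.I * |k|) B (incomingRight k) x
  have hA : EqOn ψ (planeWave (Complex.I * |k|) (incomingLeft k) A) (Iio a) :=
    fun x hx => if_pos hx
  have hu : EqOn ψ u (Ioo a b) := fun x hx =>
    (if_neg (not_lt.2 hx.1.le)).trans (if_pos hx.2)
  have hB : EqOn ψ (planeWave (Complex.I * |k|) B (incomingRight k)) (Ioi b) := fun x hx =>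
    (if_neg (not_lt.2 (hab.trans hx).le)).trans (if_neg (not_lt.2 (le_of_lt hx)))
  have n1 : Ioi b ∈ 𝓝[>] b := self_mem_nhdsWithin
  have n2 : Ioo a b ∈ 𝓝[<] b := Ioo_mem_nhdsLT hab
  have n3 : Iio a ∈ 𝓝[<] a := self_mem_nhdsWithin
  have n4 : Ioo a b ∈ 𝓝[>] a := Ioo_mem_nhdsGT hab
  have hdu := hu.deriv isOpen_Ioo
  refine ⟨ψ, ?_, ?_, exteriorConditions_iff.2 ⟨A, B, hA, hB⟩⟩
  · rw [← ofReal_abs_sq]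
    refine isSolutionOn_compl_pair ?_ ?_ ?_
    · exact (isSolutionOn_planeWave (ae_eq_zero_Iio hV hsupp) (I_mul_sq _) _ _).congr
        isOpen_Iio hA.symm
    · exact (h.sol.mono (subset_univ _)).congr isOpen_Ioo hu.symm
    · exact (isSolutionOn_planeWave (ae_eq_zero_Ioi hV hsupp) (I_mul_sq _) _ _).congr
        isOpen_Ioi hB.symm
  · exact ⟨_, _, _, _, _, _, _, _,
      tendsto_of_eventuallyEq_continuous nhdsWithin_le_nhds (hB.eventuallyEq_of_mem n1)
        (continuous_planeWave _ _ _),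
      tendsto_of_eventuallyEq_continuous nhdsWithin_le_nhds (hu.eventuallyEq_of_mem n2)
        h.sol.continuous,
      tendsto_of_eventuallyEq_continuous nhdsWithin_le_nhds
        ((hB.deriv isOpen_Ioi).eventuallyEq_of_mem n1) (continuous_deriv_planeWave _ _ _),
      tendsto_of_eventuallyEq_continuous nhdsWithin_le_nhds (hdu.eventuallyEq_of_mem n2)
        h.sol.continuous_deriv,
      tendsto_of_eventuallyEq_continuous nhdsWithin_le_nhds (hA.eventuallyEq_of_mem n3)
        (continuous_planeWave _ _ _),
      tendsto_of_eventuallyEq_continuous nhdsWithin_le_nhds (hu.eventuallyEq_of_mem n4)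
        h.sol.continuous,
      tendsto_of_eventuallyEq_continuous nhdsWithin_le_nhds
        ((hA.deriv isOpen_Iio).eventuallyEq_of_mem n3) (continuous_deriv_planeWave _ _ _),
      tendsto_of_eventuallyEq_continuous nhdsWithin_le_nhds (hdu.eventuallyEq_of_mem n4)
        h.sol.continuous_deriv,
      h.right, h.right_deriv, h.left, h.left_deriv⟩

/-! ### Solvability of the Robin problem and existence of interior parts -/

lemma exists_robin_bound_of_nonneg {V : ℝ → ℝ} (hV : Integrable V) {a b : ℝ} (hab : a < b)
    (hpos : IsPositiveDefiniteOn V a b) :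
    ∃ C : ℝ, ∀ (κ : ℝ) (τ ca cb : ℂ) (u : ℝ → ℂ), 0 ≤ κ → 1 / 2 ≤ τ.re → ‖τ‖ ≤ 2 →
      ‖ca‖ ≤ 4 → ‖cb‖ ≤ 4 → IsRobinSolution V a b κ τ ca cb u →
      ‖u a‖ ≤ C * (κ / (1 + κ)) ∧ ‖u b‖ ≤ C * (κ / (1 + κ)) ∧
      ‖deriv u a‖ ≤ 24 * κ ∧ ‖deriv u b‖ ≤ 24 * κ := by
  obtain ⟨C, hC0, hC⟩ := exists_robin_bound hV hab hpos
  refine ⟨C, fun κ τ ca cb u hκ hτ hτ' hca hcb h => ?_⟩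
  rcases hκ.eq_or_lt with rfl | hκ
  -- The sources enter with a factor `κ`, so at `κ = 0` the problem is homogeneous.
  · have h0 : IsRobinSolution V a b 0 τ 0 0 u :=
      ⟨h.sol, by simpa using h.left, by simpa using h.right⟩
    obtain ⟨h1, h2, h3, h4⟩ := h0.eq_zero hV hab hpos le_rfl hτ
    simp [h1, h2, h3, h4]
  · obtain ⟨h1, h2⟩ := hC κ τ ca cb u hκ hτ hτ' hca hcb h
    obtain ⟨h3, h4⟩ := h.norm_deriv_le hV hκ hτ hτ' hca hcb
    exact ⟨h1, h2, h3, h4⟩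

/-- Shooting from `b`: `v` meets the homogeneous and `w` the inhomogeneous condition there. A
multiple of `v` corrects `w` at `a`, because `m = 0` would make `v` a nontrivial homogeneous
solution. -/
lemma exists_isRobinSolution {V : ℝ → ℝ} (hV : Integrable V) {a b : ℝ} (hab : a < b)
    (hpos : IsPositiveDefiniteOn V a b) {κ : ℝ} (hκ : 0 ≤ κ) {τ : ℂ} (hτ : 1 / 2 ≤ τ.re)
    (ca cb : ℂ) : ∃ u, IsRobinSolution V a b κ τ ca cb u := by
  obtain ⟨v, hv, hv0, hv1⟩ :=
    exists_isSolutionOn_univ hV ((κ : ℂ) ^ 2) b 1 (Complex.I * κ * τ)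
  obtain ⟨w, hw, hw0, hw1⟩ :=
    exists_isSolutionOn_univ hV ((κ : ℂ) ^ 2) b 0 (-(Complex.I * κ * cb))
  set m := deriv v a + Complex.I * κ * τ * v a
  have hm : m ≠ 0 := fun h0 => by
    have : IsRobinSolution V a b κ τ 0 0 v :=
      ⟨hv, by rw [mul_zero]; exact h0, by rw [hv0, hv1]; ring⟩
    have := (this.eq_zero hV hab hpos hκ hτ).2.1
    simp [hv0] at this
  let r := (deriv w a + Complex.I * κ * τ * w a - Complex.I * κ * ca) / m
  have hr : r * m = deriv w a + Complex.I * κ * τ * w a - Complex.I * κ * ca :=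
    div_mul_cancel₀ _ hm
  refine ⟨w - r • v, hw.sub (hv.const_smul r), ?_, ?_⟩
  · rw [hw.deriv_sub (hv.const_smul r), hv.deriv_const_smul]
    simp only [Pi.sub_apply, Pi.smul_apply, smul_eq_mul]
    linear_combination -hr
  · rw [hw.deriv_sub (hv.const_smul r), hv.deriv_const_smul]
    simp only [Pi.sub_apply, Pi.smul_apply, smul_eq_mul]
    rw [hv0, hv1, hw0, hw1]
    ring

section InteriorPart

variable {V : ℝ → ℝ} {a b k : ℝ} {θ₁ θ₂ : ℂ} {u : ℝ → ℂ} {A B : ℂ}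

/-- The parameter of the Robin conditions satisfied by the interior parts. -/
def robinParameter (θ₁ θ₂ : ℂ) : ℂ := Complex.exp ((θ₁ - θ₂) / 2)

lemma robinParameter_mul (θ₁ θ₂ : ℂ) :
    robinParameter θ₁ θ₂ * Complex.exp (-θ₁ / 2) = Complex.exp (-θ₂ / 2) := by
  rw [robinParameter, ← Complex.exp_add]; ring_nf

lemma exp_half_mul (θ : ℂ) : Complex.exp (θ / 2) * Complex.exp (-θ / 2) = 1 := by
  rw [← Complex.exp_add, ← Complex.exp_zero]; ring_nf

/-- The source of the Robin condition at `a`. -/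
def sourceLeft (a k : ℝ) (θ₂ : ℂ) : ℂ :=
  2 * incomingLeft k * Complex.exp (-θ₂ / 2) * Complex.exp (Complex.I * |k| * a)

/-- The source of the Robin condition at `b`. -/
def sourceRight (b k : ℝ) (θ₂ : ℂ) : ℂ :=
  2 * incomingRight k * Complex.exp (-θ₂ / 2) * Complex.exp (-(Complex.I * |k| * b))

/-- The Robin combinations are those in which the outgoing amplitudes cancel; the incoming wave is
counted twice. -/
lemma IsInteriorPart.isRobinSolution (h : IsInteriorPart V a b k θ₁ θ₂ u A B) :
    IsRobinSolution V a b |k| (robinParameter θ₁ θ₂) (sourceLeft a k θ₂) (sourceRight b k θ₂) u := by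
  refine ⟨h.sol, ?_, ?_⟩
  · rw [← h.left, ← h.left_deriv, deriv_planeWave]
    simp only [planeWave, sourceLeft, Pi.smul_apply, smul_eq_mul]
    linear_combination (Complex.I * (|k| : ℝ) * (incomingLeft k * Complex.exp (Complex.I * (|k| : ℝ) * a) +
      A * Complex.exp (-(Complex.I * (|k| : ℝ) * a)))) * robinParameter_mul θ₁ θ₂
  · rw [← h.right, ← h.right_deriv, deriv_planeWave]
    simp only [planeWave, sourceRight, Pi.smul_apply, smul_eq_mul]
    linear_combination (-Complex.I * (|k| : ℝ) * (B * Complex.exp (Complex.I * (|k| : ℝ) * b) +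
      incomingRight k * Complex.exp (-(Complex.I * (|k| : ℝ) * b)))) * robinParameter_mul θ₁ θ₂

/-- The conditions on values define `A` and `B`; those on derivatives are then the Robin conditions.
-/
lemma exists_isInteriorPart (hV : Integrable V) (hab : a < b) (hpos : IsPositiveDefiniteOn V a b)
    (k : ℝ) (hτ : 1 / 2 ≤ (robinParameter θ₁ θ₂).re) :
    ∃ (u : ℝ → ℂ) (A B : ℂ), IsInteriorPart V a b k θ₁ θ₂ u A B := by
  obtain ⟨u, hu⟩ := exists_isRobinSolution hV hab hpos (abs_nonneg k) hτ
    (sourceLeft a k θ₂) (sourceRight b k θ₂)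
  have hX : ∀ x : ℝ, Complex.exp (-(Complex.I * |k| * x)) * Complex.exp (Complex.I * |k| * x) = 1 :=
    fun x => by rw [← Complex.exp_add]; simp
  have h1 := exp_half_mul θ₁
  have h2 : robinParameter θ₁ θ₂ = Complex.exp (θ₁ / 2) * Complex.exp (-θ₂ / 2) := by
    rw [robinParameter, ← Complex.exp_add]; ring_nf
  let B := (Complex.exp (θ₁ / 2) * u b -
    incomingRight k * Complex.exp (-(Complex.I * |k| * b))) * Complex.exp (-(Complex.I * |k| * b))
  let A := (Complex.exp (θ₁ / 2) * u a -
    incomingLeft k * Complex.exp (Complex.I * |k| * a)) * Complex.exp (Complex.I * |k| * a)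
  have hB : B * Complex.exp (Complex.I * |k| * b) = Complex.exp (θ₁ / 2) * u b -
      incomingRight k * Complex.exp (-(Complex.I * |k| * b)) := by
    rw [mul_assoc, hX, mul_one]
  have hA : A * Complex.exp (-(Complex.I * |k| * a)) = Complex.exp (θ₁ / 2) * u a -
      incomingLeft k * Complex.exp (Complex.I * |k| * a) := by
    rw [mul_assoc, mul_comm (Complex.exp (Complex.I * |k| * a)), hX, mul_one]
  refine ⟨u, A, B, hu.sol, ?_, ?_, ?_, ?_⟩
  · rw [planeWave, hB]
    linear_combination u b * h1
  · rw [deriv_planeWave, hu.deriv_right, h2, sourceRight]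
    simp only [Pi.smul_apply, smul_eq_mul, planeWave, hB]
    ring
  · rw [planeWave, hA]
    linear_combination u a * h1
  · rw [deriv_planeWave, hu.deriv_left, h2, sourceLeft]
    simp only [Pi.smul_apply, smul_eq_mul, planeWave, neg_mul, hA]
    ring

/-- Makes coefficients built from one chosen interior part valid for every eigenfunction. -/
lemma IsInteriorPart.boundary_eq (hV : Integrable V) (hab : a < b)
    (hpos : IsPositiveDefiniteOn V a b) (hτ : 1 / 2 ≤ (robinParameter θ₁ θ₂).re)
    (h : IsInteriorPart V a b k θ₁ θ₂ u A B) {w : ℝ → ℂ} {A' B' : ℂ}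
    (h' : IsInteriorPart V a b k θ₁ θ₂ w A' B') :
    u a = w a ∧ u b = w b ∧ deriv u a = deriv w a ∧ deriv u b = deriv w b := by
  have hs := h.isRobinSolution.sub h'.isRobinSolution
  rw [sub_self, sub_self] at hs
  have := hs.eq_zero hV hab hpos (abs_nonneg k) hτ
  simpa only [h.sol.deriv_sub h'.sol, Pi.sub_apply, sub_eq_zero] using this

end InteriorPart

/-! ### Representation of the difference by jumps -/

/-- The representation of the difference of two generalized eigenfunctions in terms of the jumps
across the interfaces. -/
lemma genEigenfunction_sub_eq {V : ℝ → ℝ} (hV : Integrable V) {a b : ℝ} (hab : a < b)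
    (hsupp : essSupport V = Icc a b) (hpos : IsPositiveDefiniteOn V a b) {k : ℝ} {θ₁ θ₂ : ℂ}
    {u u₀ ψ ψ₀ : ℝ → ℂ} {A B A₀ B₀ : ℂ}
    (hu : IsInteriorPart V a b k θ₁ θ₂ u A B) (hu₀ : IsInteriorPart V a b k 0 0 u₀ A₀ B₀)
    (hψ : EqOn ψ u (Ioo a b)) (hψ₀ : EqOn ψ₀ u₀ (Ioo a b))
    (hψa : EqOn ψ (planeWave (Complex.I * |k|) (incomingLeft k) A) (Iio a))
    (hψa₀ : EqOn ψ₀ (planeWave (Complex.I * |k|) (incomingLeft k) A₀) (Iio a))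
    (hψb : EqOn ψ (planeWave (Complex.I * |k|) B (incomingRight k)) (Ioi b))
    (hψb₀ : EqOn ψ₀ (planeWave (Complex.I * |k|) B₀ (incomingRight k)) (Ioi b))
    {x : ℝ} (hxa : x ≠ a) (hxb : x ≠ b) :
    ψ x - ψ₀ x =
      -(Complex.exp (θ₂ / 2) - 1) * deriv u b * greenG V a b (|k| : ℝ) x b +
      -(Complex.exp (θ₁ / 2) - 1) * u b * greenH V a b (|k| : ℝ) x b +
      (Complex.exp (θ₂ / 2) - 1) * deriv u a * greenG V a b (|k| : ℝ) x a +
      (Complex.exp (θ₁ / 2) - 1) * u a * greenH V a b (|k| : ℝ) x a := by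
  obtain ⟨hp, hpe⟩ := jostPlus_spec hV hsupp (|k| : ℝ)
  obtain ⟨hm, hme⟩ := jostMinus_spec hV hsupp (|k| : ℝ)
  obtain ⟨hpb, hpb'⟩ := jostPlus_apply hV hsupp (|k| : ℝ)
  obtain ⟨hma, hma'⟩ := jostMinus_apply hV hsupp (|k| : ℝ)
  have hw := jostFunction_ne_zero hV hab hsupp hpos (abs_nonneg k)
  have hwx : ∀ y, jostFunction V a b (|k| : ℝ) =
      wronskian (jostPlus V b (|k| : ℝ)) (jostMinus V a (|k| : ℝ)) y :=
    fun y => hp.wronskian_eq hV hm a y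
  simp only [greenG, greenH]
  set χp := jostPlus V b (|k| : ℝ)
  set χm := jostMinus V a (|k| : ℝ)
  set W := jostFunction V a b (|k| : ℝ)
  set c : ℂ := Complex.I * (|k| : ℝ)
  have hWi : W * W⁻¹ = 1 := mul_inv_cancel₀ hw
  have hd := hu.sol.sub hu₀.sol
  have hdd := hu.sol.deriv_sub hu₀.sol
  have hWp := fun y y' => hp.wronskian_eq hV hd y y'
  have hWm := fun y y' => hm.wronskian_eq hV hd y y'
  simp only [wronskian, hdd, Pi.sub_apply] at hWp hWm hwx
  have E₁ := exp_half_mul θ₁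
  have E₂ := exp_half_mul θ₂
  have r1 := hu.right
  have r2 := hu.right_deriv
  have l1 := hu.left
  have l2 := hu.left_deriv
  have r1₀ := hu₀.right
  have r2₀ := hu₀.right_deriv
  have l1₀ := hu₀.left
  have l2₀ := hu₀.left_deriv
  rw [deriv_planeWave] at r2 l2 r2₀ l2₀
  simp only [planeWave, Pi.smul_apply, smul_eq_mul, neg_zero, zero_div, Complex.exp_zero,
    one_mul] at r1 r2 l1 l2 r1₀ r2₀ l1₀ l2₀
  have hB : (B - B₀) * Complex.exp (c * b) = Complex.exp (θ₁ / 2) * u b - u₀ b := by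
    rw [← r1, ← r1₀]
    linear_combination (-(B * Complex.exp (c * b) + incomingRight k * Complex.exp (-(c * b)))) * E₁
  have hB' : (B - B₀) * (c * Complex.exp (c * b)) =
      Complex.exp (θ₂ / 2) * deriv u b - deriv u₀ b := by
    rw [← r2, ← r2₀]
    linear_combination
      (-(c * (B * Complex.exp (c * b) + -incomingRight k * Complex.exp (-(c * b))))) * E₂
  have hA : (A - A₀) * Complex.exp (-(c * a)) = Complex.exp (θ₁ / 2) * u a - u₀ a := by
    rw [← l1, ← l1₀]
    linear_combination (-(incomingLeft k * Complex.exp (c * a) + A * Complex.exp (-(c * a)))) * E₁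
  have hA' : (A - A₀) * (-(c * Complex.exp (-(c * a)))) =
      Complex.exp (θ₂ / 2) * deriv u a - deriv u₀ a := by
    rw [← l2, ← l2₀]
    linear_combination
      (-(c * (incomingLeft k * Complex.exp (c * a) + -A * Complex.exp (-(c * a))))) * E₂
  rw [← hpb] at hB
  rw [← hpb'] at hB'
  rw [← hma] at hA
  rw [← hma'] at hA'
  -- Outside, the difference is a multiple of `χ₊` (right) or `χ₋` (left), whose Wronskian with the
  -- same Jost solution is zero. Thus the Wronskian with `u - u₀` at the interface sees only the
  -- jump.
  have hsumb : -(Complex.exp (θ₂ / 2) - 1) * deriv u b * χp b +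
      (Complex.exp (θ₁ / 2) - 1) * u b * deriv χp b =
      χp b * (deriv u b - deriv u₀ b) - deriv χp b * (u b - u₀ b) := by
    linear_combination χp b * hB' - deriv χp b * hB
  have hsuma : (Complex.exp (θ₂ / 2) - 1) * deriv u a * χm a -
      (Complex.exp (θ₁ / 2) - 1) * u a * deriv χm a =
      -(χm a * (deriv u a - deriv u₀ a) - deriv χm a * (u a - u₀ a)) := by
    linear_combination -χm a * hA' + deriv χm a * hA
  apply mul_left_cancel₀ hw
  rcases lt_or_gt_of_ne hxa with hx | hx
  · have hxb : x < b := hx.trans hab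
    rw [if_neg (not_le.2 hx), if_neg (not_le.2 hxb), if_neg (not_le.2 hx), if_neg (not_le.2 hxb),
      hψa hx, hψa₀ hx]
    have hχ : χm x = Complex.exp (-(c * x)) := by rw [hme hx]; simp [planeWave, c]
    have key : W * (A - A₀) = (-(Complex.exp (θ₂ / 2) - 1) * deriv u b * χp b +
        (Complex.exp (θ₁ / 2) - 1) * u b * deriv χp b) +
        (Complex.exp (θ₂ / 2) - 1) * deriv u a * χp a -
        (Complex.exp (θ₁ / 2) - 1) * u a * deriv χp a := by
      rw [hsumb, hWp b a, hwx a]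
      linear_combination χp a * hA' - deriv χp a * hA
    simp only [planeWave, ← hχ]
    linear_combination χm x * key - (χm x * ((-(Complex.exp (θ₂ / 2) - 1) * deriv u b * χp b +
        (Complex.exp (θ₁ / 2) - 1) * u b * deriv χp b) +
        (Complex.exp (θ₂ / 2) - 1) * deriv u a * χp a -
        (Complex.exp (θ₁ / 2) - 1) * u a * deriv χp a)) * hWi
  · rcases lt_or_gt_of_ne hxb with hx' | hx'
    · rw [if_pos hx.le, if_neg (not_le.2 hx'), if_pos hx.le, if_neg (not_le.2 hx'),
        hψ ⟨hx, hx'⟩, hψ₀ ⟨hx, hx'⟩]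
      -- With `d = u - u₀` and `[·, ·]` the Wronskian, `W d = χ₋ [χ₊, d] - χ₊ [χ₋, d]`; constancy
      -- moves the brackets to `b` and `a`.
      have key : W * (u x - u₀ x) = χm x * (-(Complex.exp (θ₂ / 2) - 1) * deriv u b * χp b +
          (Complex.exp (θ₁ / 2) - 1) * u b * deriv χp b) +
          χp x * ((Complex.exp (θ₂ / 2) - 1) * deriv u a * χm a -
          (Complex.exp (θ₁ / 2) - 1) * u a * deriv χm a) := by
        rw [hsumb, hsuma, hWp b x, hWm a x, hwx x]
        ring
      linear_combination key - (χm x * (-(Complex.exp (θ₂ / 2) - 1) * deriv u b * χp b +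
          (Complex.exp (θ₁ / 2) - 1) * u b * deriv χp b) +
          χp x * ((Complex.exp (θ₂ / 2) - 1) * deriv u a * χm a -
          (Complex.exp (θ₁ / 2) - 1) * u a * deriv χm a)) * hWi
    · rw [if_pos hx.le, if_pos (le_of_lt hx'), if_pos hx.le, if_pos (le_of_lt hx'),
        hψb hx', hψb₀ hx']
      have hχ : χp x = Complex.exp (c * x) := by rw [hpe hx']; simp [planeWave, c]
      have key : W * (B - B₀) = -(Complex.exp (θ₂ / 2) - 1) * deriv u b * χm b +
          (Complex.exp (θ₁ / 2) - 1) * u b * deriv χm b +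
          ((Complex.exp (θ₂ / 2) - 1) * deriv u a * χm a -
          (Complex.exp (θ₁ / 2) - 1) * u a * deriv χm a) := by
        rw [hsuma, hWm a b, hwx b]
        linear_combination deriv χm b * hB - χm b * hB'
      simp only [planeWave, ← hχ]
      linear_combination χp x * key - (χp x * (-(Complex.exp (θ₂ / 2) - 1) * deriv u b * χm b +
          (Complex.exp (θ₁ / 2) - 1) * u b * deriv χm b +
          ((Complex.exp (θ₂ / 2) - 1) * deriv u a * χm a -
          (Complex.exp (θ₁ / 2) - 1) * u a * deriv χm a))) * hWi

/-! ### Smallness of the parameters and conclusion -/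

lemma isLandauO_of_norm_le {X : Type*} {f g : X → ℂ} {C : ℝ} (h : ∀ x, ‖f x‖ ≤ C * ‖g x‖) :
    IsLandauO f g := by
  -- Where `g` vanishes the bound forces `f = 0`, and the quotient is `0` by convention.
  refine ⟨fun x => f x / g x, ⟨max C 0, fun x => ?_⟩, fun x => ?_⟩
  · rw [norm_div]
    refine div_le_of_le_mul₀ (norm_nonneg _) (le_max_right _ _) ((h x).trans ?_)
    gcongr
    exact le_max_left _ _
  · by_cases hg : g x = 0
    · have := h x
      rw [hg, norm_zero, mul_zero] at this
      rw [norm_le_zero_iff.1 this, hg]; simp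
    · rw [div_mul_cancel₀ _ hg]

lemma norm_exp_half_sub_one_le {θ : ℂ} (hθ : ‖θ‖ ≤ 2) : ‖Complex.exp (θ / 2) - 1‖ ≤ ‖θ‖ := by
  have h : ‖θ / 2‖ = ‖θ‖ / 2 := by simp
  have := Complex.norm_exp_sub_one_le (x := θ / 2) (by rw [h]; linarith)
  rw [h] at this
  linarith

lemma norm_exp_half_le {θ : ℂ} (hθ : ‖θ‖ ≤ 1) : ‖Complex.exp (θ / 2)‖ ≤ 2 := by
  have h1 := norm_exp_half_sub_one_le (hθ.trans one_le_two)
  have h2 := norm_add_le (Complex.exp (θ / 2) - 1) 1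
  rw [sub_add_cancel, norm_one] at h2
  linarith

/-- The radius `1/4` gives `|τ - 1| ≤ |θ₁ - θ₂| ≤ 1/2`, which is what the Robin bounds need. -/
lemma robinParameter_bounds {θ₁ θ₂ : ℂ} (h₁ : ‖θ₁‖ ≤ 1 / 4) (h₂ : ‖θ₂‖ ≤ 1 / 4) :
    1 / 2 ≤ (robinParameter θ₁ θ₂).re ∧ ‖robinParameter θ₁ θ₂‖ ≤ 2 := by
  have h : ‖θ₁ - θ₂‖ ≤ 1 / 2 := (norm_sub_le _ _).trans (by linarith)
  refine ⟨?_, norm_exp_half_le (h.trans (by norm_num))⟩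
  have h3 := norm_exp_half_sub_one_le (h.trans (by norm_num))
  have h4 := (abs_le.1 (Complex.abs_re_le_norm (Complex.exp ((θ₁ - θ₂) / 2) - 1))).1
  rw [Complex.sub_re, Complex.one_re] at h4
  rw [robinParameter]
  linarith

lemma norm_source_le {θ₂ : ℂ} (h₂ : ‖θ₂‖ ≤ 1 / 4) (x k : ℝ) :
    ‖sourceLeft x k θ₂‖ ≤ 4 ∧ ‖sourceRight x k θ₂‖ ≤ 4 := by
  have h : ‖Complex.exp (-θ₂ / 2)‖ ≤ 2 := norm_exp_half_le (by rw [norm_neg]; linarith)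
  have e1 : ‖Complex.exp (Complex.I * |k| * x)‖ = 1 := by simp [Complex.norm_exp]
  have e2 : ‖Complex.exp (-(Complex.I * |k| * x))‖ = 1 := by simp [Complex.norm_exp]
  have hl := norm_incomingLeft_le k
  have hr := norm_incomingRight_le k
  simp only [sourceLeft, sourceRight, norm_mul, e1, e2, mul_one, Complex.norm_ofNat]
  constructor
  · calc _ ≤ 2 * 1 * 2 := by gcongr
      _ = (4 : ℝ) := by norm_num
  · calc _ ≤ 2 * 1 * 2 := by gcongr
      _ = (4 : ℝ) := by norm_num

end InterfaceScattering
end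

theorem corollary1 (V : ℝ → ℝ) (a b : ℝ) (hab : a < b)
    (hV : MeasureTheory.Integrable V)
    (hsupp : InterfaceScattering.essSupport V = Set.Icc a b)
    (hpos : InterfaceScattering.IsPositiveDefiniteOn V a b) :
    ∃ δ : ℝ, 0 < δ ∧
      (∀ (k : ℝ) (θ : Metric.ball (0 : ℂ × ℂ) δ),
        ∃ ψ : ℝ → ℂ, InterfaceScattering.IsGenEigenfunction V a b k θ.1.1 θ.1.2 ψ) ∧
      ∃ gb hb ga ha : ℝ × Metric.ball (0 : ℂ × ℂ) δ → ℂ,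
        InterfaceScattering.IsLandauO gb (fun p => p.2.1.2 * (p.1 : ℂ)) ∧
        InterfaceScattering.IsLandauO hb (fun p => p.2.1.1 * (p.1 : ℂ) / (1 + |p.1| : ℝ)) ∧
        InterfaceScattering.IsLandauO ga (fun p => p.2.1.2 * (p.1 : ℂ)) ∧
        InterfaceScattering.IsLandauO ha (fun p => p.2.1.1 * (p.1 : ℂ) / (1 + |p.1| : ℝ)) ∧
        ∀ (k : ℝ) (θ : Metric.ball (0 : ℂ × ℂ) δ) (ψ ψ₀ : ℝ → ℂ),
          InterfaceScattering.IsGenEigenfunction V a b k θ.1.1 θ.1.2 ψ →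
          InterfaceScattering.IsGenEigenfunction V a b k 0 0 ψ₀ →
          ∀ x : ℝ, x ≠ a → x ≠ b →
            ψ x - ψ₀ x =
              gb (k, θ) * InterfaceScattering.greenG V a b (Real.sign k * k : ℝ) x b +
              hb (k, θ) * InterfaceScattering.greenH V a b (Real.sign k * k : ℝ) x b +
              ga (k, θ) * InterfaceScattering.greenG V a b (Real.sign k * k : ℝ) x a +
              ha (k, θ) * InterfaceScattering.greenH V a b (Real.sign k * k : ℝ) x a := by
  open InterfaceScattering in
  have hθ : ∀ θ : Metric.ball (0 : ℂ × ℂ) (1 / 4), ‖θ.1.1‖ ≤ 1 / 4 ∧ ‖θ.1.2‖ ≤ 1 / 4 := by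
    intro θ
    have h := (mem_ball_zero_iff.1 θ.2).le
    exact ⟨(norm_fst_le _).trans h, (norm_snd_le _).trans h⟩
  have hτ := fun θ => robinParameter_bounds (hθ θ).1 (hθ θ).2
  have hex := fun (p : ℝ × Metric.ball (0 : ℂ × ℂ) (1 / 4)) =>
    exists_isInteriorPart hV hab hpos p.1 (hτ p.2).1
  -- The coefficients must depend on `(k, θ)` alone, so interior parts are fixed before any `ψ` is
  -- given.
  choose u A B hu using hex
  obtain ⟨C, hC⟩ := exists_robin_bound_of_nonneg hV hab hpos
  have hbd := fun p => hC |p.1| _ _ _ (u p) (abs_nonneg p.1) (hτ p.2).1 (hτ p.2).2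
    (norm_source_le (hθ p.2).2 a p.1).1 (norm_source_le (hθ p.2).2 b p.1).2 (hu p).isRobinSolution
  have h₁ := fun θ => norm_exp_half_sub_one_le ((hθ θ).1.trans (by norm_num))
  have h₂ := fun θ => norm_exp_half_sub_one_le ((hθ θ).2.trans (by norm_num))
  refine ⟨1 / 4, by norm_num, fun k θ => (hu (k, θ)).exists_genEigenfunction hV hab hsupp,
    fun p => -(Complex.exp (p.2.1.2 / 2) - 1) * deriv (u p) b,
    fun p => -(Complex.exp (p.2.1.1 / 2) - 1) * u p b,
    fun p => (Complex.exp (p.2.1.2 / 2) - 1) * deriv (u p) a,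
    fun p => (Complex.exp (p.2.1.1 / 2) - 1) * u p a, ?_, ?_, ?_, ?_, ?_⟩
  · refine isLandauO_of_norm_le (C := 24) fun p => ?_
    rw [norm_mul, norm_neg, norm_mul, Complex.norm_real, Real.norm_eq_abs]
    calc _ ≤ ‖p.2.1.2‖ * (24 * |p.1|) := by gcongr; exacts [h₂ p.2, (hbd p).2.2.2]
      _ = _ := by ring
  · refine isLandauO_of_norm_le (C := C) fun p => ?_
    rw [norm_mul, norm_neg, norm_div, norm_mul, Complex.norm_real, Complex.norm_real,
      Real.norm_eq_abs, Real.norm_of_nonneg (r := 1 + |p.1|) (by positivity)]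
    calc _ ≤ ‖p.2.1.1‖ * (C * (|p.1| / (1 + |p.1|))) := by
          gcongr; exacts [h₁ p.2, (hbd p).2.1]
      _ = _ := by ring
  · refine isLandauO_of_norm_le (C := 24) fun p => ?_
    rw [norm_mul, norm_mul, Complex.norm_real, Real.norm_eq_abs]
    calc _ ≤ ‖p.2.1.2‖ * (24 * |p.1|) := by gcongr; exacts [h₂ p.2, (hbd p).2.2.1]
      _ = _ := by ring
  · refine isLandauO_of_norm_le (C := C) fun p => ?_
    rw [norm_mul, norm_div, norm_mul, Complex.norm_real, Complex.norm_real,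
      Real.norm_eq_abs, Real.norm_of_nonneg (r := 1 + |p.1|) (by positivity)]
    calc _ ≤ ‖p.2.1.1‖ * (C * (|p.1| / (1 + |p.1|))) := by
          gcongr; exacts [h₁ p.2, (hbd p).1]
      _ = _ := by ring
  · intro k θ ψ ψ₀ hψ hψ₀ x hxa hxb
    -- At `k = 0` the convention `Real.sign 0 = 0` is harmless.
    have hk : Real.sign k * k = |k| := by
      rcases lt_trichotomy k 0 with h | rfl | h
      · rw [Real.sign_of_neg h, abs_of_neg h]; ring
      · simp
      · rw [Real.sign_of_pos h, abs_of_pos h, one_mul]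
    obtain ⟨v, A', B', hv, e1, e2, e3⟩ := hψ.exists_interiorPart hV hab
    obtain ⟨v₀, A₀, B₀, hv₀, e1₀, e2₀, e3₀⟩ := hψ₀.exists_interiorPart hV hab
    obtain ⟨m1, m2, m3, m4⟩ := (hu (k, θ)).boundary_eq hV hab hpos (hτ θ).1 hv
    rw [hk]
    simp only [m1, m2, m3, m4]
    exact genEigenfunction_sub_eq hV hab hsupp hpos hv hv₀ e1 e1₀ e2 e2₀ e3 e3₀ hxa hxb
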